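/- **Mackey's formula for condensed groups.** Let $\mathrm{CHED}$ be the category of extremally disconnected compact Hausdorff spaces, with finite jointly surjective families as covers. A condensed set (group, ring, …) is a sheaf of sets (groups, rings, …) on it, and $T(*)$ denotes the value of $T$ at the point. Let $R$ be a condensed ring (unital, not necessarily commutative), $G$ a condensed group, and $H,K\le G$ condensed subgroups. Suppose that $H$ is open in $G$ or that $K$ is open in $G$. Here $H$ is open in $G$ if for every $S\in\mathrm{CHED}$ and every map $\underline S\to G$ the pullback $\underline S\times_G H$ is represented by an open subset of $S$. The condensed group ring $R[G]$ is the sheafification of $S\mapsto R(S)[G(S)]$. For $g\in G(*)$, $R[Hg]$ is the sheafification of $S\mapsto R(S)[H(S)g]$ (formal $R(S)$-linear combinations of elements of the coset); multiplication makes it an $R[H]$-$R[g^{-1}Hg]$-bimodule. The tensor product $M\otimes_A N$ of condensed modules is the sheaf associated with $S\mapsto M(S)\otimes_{A(S)}N(S)$. For condensed groups $H\le G$, the induced module of a condensed right $R[H]$-module $M$ is the right $R[G]$-module $\mathrm{Ind}^G_H M=M\otimes_{R[H]}R[G]$, and $\mathrm{Res}^G_H$ is restriction of scalars along $R[H]\to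 R[G]$. Let $M$ be a condensed right $R[H]$-module. Then there is an isomorphism of condensed right $R[K]$-modules $$\mathrm{Res}^G_K\,\mathrm{Ind}^G_H M\;\cong\;\bigoplus_{g\in (H\backslash G/K)(*)}\mathrm{Ind}^K_{K\cap g^{-1}Hg}\,\mathrm{Res}^{g^{-1}Hg}_{K\cap g^{-1}Hg}\bigl(M\otimes_{R[H]}R[Hg]\bigr),$$ where the direct sum is that of condensed right $R[K]$-modules, and $g\in G(*)$ runs over an arbitrary system of representatives of the double cosets $(H\backslash G/K)(*)=H(*)\backslash G(*)/K(*)$. -/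

import Mathlib

universe u

open CategoryTheory Limits Opposite
open scoped TensorProduct

namespace CondMackey

noncomputable section

/-! ### Condensed objects -/

/-- The topology on extremally disconnected compact Hausdorff spaces whose coverings are generated
by finite jointly surjective families. -/
abbrev topo : GrothendieckTopology Stonean.{u} := coherentTopology Stonean.{u}

/-- Condensed rings (unital, not necessarily commutative). -/
abbrev CondRing := Sheaf topo.{u} RingCat.{u + 1}

/-- Condensed groups. -/
abbrev CondGrp := Sheaf topo.{u} GrpCat.{u + 1}

/-- The one-point space. -/
abbrev pt : Stonean.{u} := Stonean.of PUnit.{u + 1}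

/-- The unique map from `S` to the point. -/
def toPt (S : Stonean.{u}) : S ⟶ pt.{u} := CompHausLike.isTerminalPUnit.from S

lemma comp_toPt {S T : Stonean.{u}} (f : T ⟶ S) : f ≫ toPt S = toPt T :=
  CompHausLike.isTerminalPUnit.hom_ext _ _

/-- The underlying group `G(*)` of a condensed group. -/
abbrev CondGrp.underlying (G : CondGrp.{u}) : GrpCat.{u + 1} := G.obj.obj (op pt)

/-- The restriction to `S` of an element `g` of the underlying group `G(*)`. -/
def CondGrp.const (G : CondGrp.{u}) (g : CondGrp.underlying G) (S : Stonean.{u}ᵒᵖ) : G.obj.obj S :=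
  (G.obj.map (toPt S.unop).op).hom g

lemma CondGrp.map_const (G : CondGrp.{u}) (g : CondGrp.underlying G) {S T : Stonean.{u}ᵒᵖ}
    (f : S ⟶ T) : (G.obj.map f).hom (CondGrp.const G g S) = CondGrp.const G g T := by
  have h : (toPt S.unop).op ≫ f = (toPt T.unop).op := by
    rw [← comp_toPt f.unop]; rfl
  simp only [CondGrp.const, ← h, Functor.map_comp, GrpCat.hom_comp, MonoidHom.comp_apply]

/-! ### Condensed subgroups -/

/-- A condensed subgroup of `G`: a subpresheaf of groups of `G` which is a sheaf, i.e. which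
contains every section of `G` that belongs to it locally. -/
@[ext]
structure CondSubgroup (G : CondGrp.{u}) where
  /-- the sections over `S` -/
  obj (S : Stonean.{u}ᵒᵖ) : Subgroup (G.obj.obj S)
  map_mem {S T : Stonean.{u}ᵒᵖ} (f : S ⟶ T) {x : G.obj.obj S} (hx : x ∈ obj S) :
    (G.obj.map f).hom x ∈ obj T
  local_mem {S : Stonean.{u}} (x : G.obj.obj (op S)) (C : Sieve S) (hC : C ∈ topo S)
    (hx : ∀ ⦃T : Stonean.{u}⦄ (f : T ⟶ S), C f → (G.obj.map f.op).hom x ∈ obj (op T)) :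
    x ∈ obj (op S)

namespace CondSubgroup

variable {G : CondGrp.{u}}

/-- The restriction maps of a condensed subgroup. -/
def restr (H : CondSubgroup G) {S T : Stonean.{u}ᵒᵖ} (f : S ⟶ T) : H.obj S →* H.obj T :=
  ((G.obj.map f).hom.comp (H.obj S).subtype).codRestrict (H.obj T) fun x => H.map_mem f x.2

@[simp]
lemma coe_restr (H : CondSubgroup G) {S T : Stonean.{u}ᵒᵖ} (f : S ⟶ T) (x : H.obj S) :
    (H.restr f x : G.obj.obj T) = (G.obj.map f).hom x := rfl

/-- The underlying presheaf of groups of a condensed subgroup. -/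
def toPresheaf (H : CondSubgroup G) : Stonean.{u}ᵒᵖ ⥤ GrpCat.{u + 1} where
  obj S := GrpCat.of (H.obj S)
  map f := GrpCat.ofHom (H.restr f)
  map_id S := by ext x; simp
  map_comp f g := by ext x; simp

/-- The underlying subpresheaf of sets. -/
def toSubfunctor (H : CondSubgroup G) : Subfunctor (G.obj ⋙ forget GrpCat.{u + 1}) where
  obj S := (H.obj S : Set (G.obj.obj S))
  map f _ hx := H.map_mem f hx

lemma isSheaf (H : CondSubgroup G) : Presheaf.IsSheaf topo.{u} H.toPresheaf := by
  rw [Presheaf.isSheaf_iff_isSheaf_forget topo H.toPresheaf (forget GrpCat.{u + 1}),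
    isSheaf_iff_isSheaf_of_type]
  have hG : Presieve.IsSheaf topo.{u} (G.obj ⋙ forget GrpCat.{u + 1}) := by
    rw [← isSheaf_iff_isSheaf_of_type]
    exact (Presheaf.isSheaf_iff_isSheaf_forget topo G.obj (forget GrpCat.{u + 1})).1 G.property
  have h : Presieve.IsSheaf topo.{u} H.toSubfunctor.toFunctor := by
    rw [Subfunctor.isSheaf_iff _ hG]
    intro S x hx
    exact H.local_mem (S := S.unop) x _ hx fun T f hf => hf
  exact h

/-- A condensed subgroup, as a condensed group. -/
def toCondGrp (H : CondSubgroup G) : CondGrp.{u} := ⟨H.toPresheaf, H.isSheaf⟩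

/-- The inclusion of a condensed subgroup. -/
def incl (H : CondSubgroup G) : H.toCondGrp ⟶ G :=
  ⟨{ app S := GrpCat.ofHom (H.obj S).subtype, naturality _ _ _ := rfl }⟩

instance : LE (CondSubgroup G) := ⟨fun H K => ∀ S, H.obj S ≤ K.obj S⟩

/-- The inclusion of a condensed subgroup in a larger one. -/
def inclOfLE {H K : CondSubgroup G} (h : H ≤ K) : H.toCondGrp ⟶ K.toCondGrp :=
  ⟨{ app S := GrpCat.ofHom (Subgroup.inclusion (h S)), naturality _ _ _ := rfl }⟩

/-- The intersection of two condensed subgroups. -/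
instance : Min (CondSubgroup G) where
  min H K :=
    { obj S := H.obj S ⊓ K.obj S
      map_mem f _ hx := ⟨H.map_mem f hx.1, K.map_mem f hx.2⟩
      local_mem x C hC hx :=
        ⟨H.local_mem x C hC fun _ f hf => (hx f hf).1,
          K.local_mem x C hC fun _ f hf => (hx f hf).2⟩ }

lemma inf_le_left (H K : CondSubgroup G) : H ⊓ K ≤ H := fun _ _ hx => hx.1

lemma inf_le_right (H K : CondSubgroup G) : H ⊓ K ≤ K := fun _ _ hx => hx.2

/-- The conjugate `g⁻¹ H g` of a condensed subgroup by an element `g` of `G(*)`: a section `x`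
belongs to it if and only if `g * x * g⁻¹` belongs to `H`. -/
def conj (H : CondSubgroup G) (g : CondGrp.underlying G) : CondSubgroup G where
  obj S := (H.obj S).comap (MulAut.conj (CondGrp.const G g S)).toMonoidHom
  map_mem {S T} f x hx := by
    have := H.map_mem f hx
    simpa [Subgroup.mem_comap, CondGrp.map_const] using this
  local_mem {S} x C hC hx := by
    refine H.local_mem (S := S) _ C hC fun T f hf => ?_
    have := hx f hf
    simpa [Subgroup.mem_comap, CondGrp.map_const] using this

/-- `H` is open in `G`: for every `S` and every map `S ⟶ G`, i.e. (by the Yoneda lemma) every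
section `x` of `G` over `S`, the pullback of `H` to `S`, whose `T`-points are the maps `f : T ⟶ S`
such that the restriction of `x` along `f` belongs to `H`, is represented by an open subset `U`
of `S`. -/
def IsOpen (H : CondSubgroup G) : Prop :=
  ∀ (S : Stonean.{u}) (x : G.obj.obj (op S)), ∃ U : Set S, _root_.IsOpen U ∧
    ∀ (T : Stonean.{u}) (f : T ⟶ S),
      (G.obj.map f.op).hom x ∈ H.obj (op T) ↔ ∀ t : T, f t ∈ U

/-- The underlying set `(H \ G / K)(*)` of the condensed set of double cosets. Orbit sets are
computed pointwise, so this is the set of double cosets of `H(*)` and `K(*)` in `G(*)`. -/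
abbrev DoubleCosets (H K : CondSubgroup G) : Type (u + 1) :=
  DoubleCoset.Quotient (G := CondGrp.underlying G)
    (H.obj (op pt) : Set (CondGrp.underlying G)) (K.obj (op pt) : Set (CondGrp.underlying G))

end CondSubgroup

/-! ### Right modules -/

/-- The opposite of a presheaf of rings. -/
def opPresheaf (A : Stonean.{u}ᵒᵖ ⥤ RingCat.{u + 1}) : Stonean.{u}ᵒᵖ ⥤ RingCat.{u + 1} where
  obj S := RingCat.of (A.obj S)ᵐᵒᵖ
  map f := RingCat.ofHom (A.map f).hom.op
  map_id S := by ext x; simp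
  map_comp f g := by ext x; simp

lemma opPresheaf_isSheaf (A : CondRing.{u}) :
    Presheaf.IsSheaf topo.{u} (opPresheaf A.obj) := by
  rw [Presheaf.isSheaf_iff_isSheaf_forget topo _ (forget RingCat.{u + 1})]
  have e : A.obj ⋙ forget RingCat.{u + 1} ≅ opPresheaf A.obj ⋙ forget RingCat.{u + 1} :=
    NatIso.ofComponents (fun S => Equiv.toIso MulOpposite.opEquiv) fun f => rfl
  exact (Presheaf.isSheaf_of_iso_iff e).1
    ((Presheaf.isSheaf_iff_isSheaf_forget topo _ (forget RingCat.{u + 1})).1 A.property)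

/-- The opposite of a condensed ring. -/
def opRing (A : CondRing.{u}) : CondRing.{u} := ⟨opPresheaf A.obj, opPresheaf_isSheaf A⟩

/-- The morphism of opposite presheaves of rings. -/
def opPresheafMap {A B : Stonean.{u}ᵒᵖ ⥤ RingCat.{u + 1}} (φ : A ⟶ B) :
    opPresheaf A ⟶ opPresheaf B where
  app S := RingCat.ofHom (φ.app S).hom.op
  naturality S T f := by
    ext x
    exact congrArg MulOpposite.op
      (RingHom.congr_fun (congrArg RingCat.Hom.hom (φ.naturality f)) x.unop)

/-- The morphism of opposite condensed rings. -/
def opRingMap {A B : CondRing.{u}} (φ : A ⟶ B) : opRing A ⟶ opRing B :=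
  ⟨opPresheafMap φ.hom⟩

/-- Condensed right modules over the condensed ring `A`, i.e. (left) sheaves of modules over the
opposite ring. -/
abbrev RightMod (A : CondRing.{u}) := SheafOfModules.{u + 1} (opRing A)

/-- Restriction of condensed right modules along a morphism of condensed rings. -/
abbrev res {A B : CondRing.{u}} (φ : A ⟶ B) : RightMod B ⥤ RightMod A :=
  SheafOfModules.restrictScalars (opRingMap φ)

/-! ### Group rings -/

section GroupRing

/-- The ring homomorphism `k[Γ] → l[Δ]` induced by `k → l` and `Γ → Δ`. -/
def monoidAlgebraMap {k l Γ Δ : Type*} [Ring k] [Ring l] [Group Γ] [Group Δ]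
    (φ : k →+* l) (f : Γ →* Δ) : MonoidAlgebra k Γ →+* MonoidAlgebra l Δ :=
  (MonoidAlgebra.mapDomainRingHom l f).comp (MonoidAlgebra.mapRingHom Γ φ)

lemma monoidAlgebraMap_single {k l Γ Δ : Type*} [Ring k] [Ring l] [Group Γ] [Group Δ]
    (φ : k →+* l) (f : Γ →* Δ) (x : Γ) (r : k) :
    monoidAlgebraMap φ f (MonoidAlgebra.single x r) = MonoidAlgebra.single (f x) (φ r) := by
  simp [monoidAlgebraMap]

lemma monoidAlgebraMap_comp {k l m Γ Δ Λ : Type*} [Ring k] [Ring l] [Ring m] [Group Γ] [Group Δ]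
    [Group Λ] (φ : k →+* l) (f : Γ →* Δ) (φ' : l →+* m) (f' : Δ →* Λ) :
    (monoidAlgebraMap φ' f').comp (monoidAlgebraMap φ f) =
      monoidAlgebraMap (φ'.comp φ) (f'.comp f) :=
  MonoidAlgebra.ringHom_ext (fun r => by simp [monoidAlgebraMap_single])
    fun x => by simp [monoidAlgebraMap_single]

/-- The presheaf of group rings `S ↦ R(S)[G(S)]`. -/
def groupRingPresheaf (R : CondRing.{u}) (G : CondGrp.{u}) : Stonean.{u}ᵒᵖ ⥤ RingCat.{u + 1} where
  obj S := RingCat.of (MonoidAlgebra (R.obj.obj S) (G.obj.obj S))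
  map f := RingCat.ofHom (monoidAlgebraMap (R.obj.map f).hom (G.obj.map f).hom)
  map_id S := by
    ext x <;> simp [monoidAlgebraMap_single]
  map_comp f g := by
    ext x <;> simp [monoidAlgebraMap_single]

/-- The morphism of presheaves of group rings induced by a morphism of condensed groups. -/
def groupRingPresheafMap (R : CondRing.{u}) {G G' : CondGrp.{u}} (f : G ⟶ G') :
    groupRingPresheaf R G ⟶ groupRingPresheaf R G' where
  app S := RingCat.ofHom (monoidAlgebraMap (RingHom.id _) (f.hom.app S).hom)
  naturality S T φ := by
    refine RingCat.hom_ext ?_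
    change (monoidAlgebraMap (RingHom.id _) (f.hom.app T).hom).comp
      (monoidAlgebraMap (R.obj.map φ).hom (G.obj.map φ).hom) =
      (monoidAlgebraMap (R.obj.map φ).hom (G'.obj.map φ).hom).comp
        (monoidAlgebraMap (RingHom.id _) (f.hom.app S).hom)
    rw [monoidAlgebraMap_comp, monoidAlgebraMap_comp]
    exact congrArg _ (congrArg GrpCat.Hom.hom (f.hom.naturality φ))

/-- The condensed group ring `R[G]`: the sheafification of `S ↦ R(S)[G(S)]`. -/
def groupRing (R : CondRing.{u}) (G : CondGrp.{u}) : CondRing.{u} :=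
  (presheafToSheaf topo RingCat.{u + 1}).obj (groupRingPresheaf R G)

/-- The morphism from the presheaf of group rings to its sheafification. -/
def toGroupRing (R : CondRing.{u}) (G : CondGrp.{u}) :
    groupRingPresheaf R G ⟶ (groupRing R G).obj :=
  toSheafify topo (groupRingPresheaf R G)

instance (R : CondRing.{u}) (G : CondGrp.{u}) :
    Presheaf.IsLocallyInjective topo (toGroupRing R G) :=
  inferInstanceAs (Presheaf.IsLocallyInjective topo (toSheafify topo (groupRingPresheaf R G)))

instance (R : CondRing.{u}) (G : CondGrp.{u}) :
    Presheaf.IsLocallySurjective topo (toGroupRing R G) :=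
  inferInstanceAs (Presheaf.IsLocallySurjective topo (toSheafify topo (groupRingPresheaf R G)))

/-- The morphism of condensed group rings induced by a morphism of condensed groups. -/
def groupRingMap (R : CondRing.{u}) {G G' : CondGrp.{u}} (f : G ⟶ G') :
    groupRing R G ⟶ groupRing R G' :=
  (presheafToSheaf topo RingCat.{u + 1}).map (groupRingPresheafMap R f)

end GroupRing

/-! ### Tensor products over a noncommutative ring -/

section Tensor

variable (A B M N : Type*) [Ring A] [Ring B] [AddCommGroup M] [Module Aᵐᵒᵖ M] [AddCommGroup N]
  [Module A N] [Module Bᵐᵒᵖ N]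

/-- The relations `m ⊗ (a • n) = (m • a) ⊗ n` defining `M ⊗_A N`. The two factors are exchanged, so
that the right action of `B` on `N` is an action on the left-hand factor of `N ⊗[ℤ] M`. When the
actions of `A` and `B` on `N` commute, the generators are stable under `B`, so that their
`B`-span is the additive subgroup that they generate. -/
def tensorRel : Submodule Bᵐᵒᵖ (N ⊗[ℤ] M) :=
  Submodule.span Bᵐᵒᵖ {z | ∃ (n : N) (a : A) (m : M),
    z = (a • n) ⊗ₜ[ℤ] m - n ⊗ₜ[ℤ] (MulOpposite.op a • m)}

/-- The tensor product `M ⊗_A N` of a right `A`-module `M` and an `A`-`B`-bimodule `N`,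
a right `B`-module. -/
abbrev BalTensor := (N ⊗[ℤ] M) ⧸ tensorRel A B M N

variable {A B M N} {A' B' M' N' : Type*} [Ring A'] [Ring B'] [AddCommGroup M'] [Module A'ᵐᵒᵖ M']
  [AddCommGroup N'] [Module A' N'] [Module B'ᵐᵒᵖ N']

/-- The map `M ⊗_A N → M' ⊗_A' N'` induced by maps `M → M'` and `N → N'` which are semilinear along
`A → A'` and `B → B'`. -/
def BalTensor.map (α : A →+* A') (β : Bᵐᵒᵖ →+* B'ᵐᵒᵖ) (f : M →+ M') (h : N →ₛₗ[β] N')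
    (hf : ∀ (a : A) (m : M), f (MulOpposite.op a • m) = MulOpposite.op (α a) • f m)
    (hh : ∀ (a : A) (n : N), h (a • n) = α a • h n) :
    BalTensor A B M N →ₛₗ[β] BalTensor A' B' M' N' :=
  Submodule.mapQ _ _
    { toFun := TensorProduct.map h.toAddMonoidHom.toIntLinearMap f.toIntLinearMap
      map_add' := map_add _
      map_smul' := fun b x => by
        induction x with
        | zero => simp
        | add x y hx hy => simp only [smul_add, map_add, hx, hy]
        | tmul n m => simp [TensorProduct.smul_tmul'] }
    (by
      refine Submodule.span_le.2 ?_
      rintro _ ⟨n, a, m, rfl⟩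
      refine Submodule.subset_span ⟨h n, α a, f m, ?_⟩
      simp [hf, hh])

end Tensor

/-! ### Bimodules -/

/-- The right action of `A(S)` on the sections over `S` of a condensed right `A`-module. -/
instance rightModule {A : CondRing.{u}} (M : RightMod A) (S : Stonean.{u}ᵒᵖ) :
    Module (A.obj.obj S)ᵐᵒᵖ (M.val.obj S) :=
  inferInstanceAs (Module ((opRing A).obj.obj S) (M.val.obj S))

/-- The restriction maps of a condensed right module. -/
def restr {A : CondRing.{u}} (M : RightMod A) {S T : Stonean.{u}ᵒᵖ} (f : S ⟶ T) :
    M.val.obj S →ₛₗ[(A.obj.map f).hom.op] M.val.obj T where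
  toFun x := M.val.map f x
  map_add' := map_add (M.val.map f).hom
  map_smul' r x := M.val.map_smul f r x

lemma restr_id {A : CondRing.{u}} (M : RightMod A) (S : Stonean.{u}ᵒᵖ) (x : M.val.obj S) :
    restr M (𝟙 S) x = x :=
  ConcreteCategory.congr_hom (M.val.presheaf.map_id S) x

lemma restr_comp {A : CondRing.{u}} (M : RightMod A) {S T U : Stonean.{u}ᵒᵖ} (f : S ⟶ T)
    (g : T ⟶ U) (x : M.val.obj S) : restr M (f ≫ g) x = restr M g (restr M f x) :=
  ConcreteCategory.congr_hom (M.val.presheaf.map_comp f g) x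

/-- Condensed `A`-`B`-bimodules: a condensed right `B`-module with a commuting left action
of `A`. -/
structure Bimod (A B : CondRing.{u}) where
  /-- the underlying right module -/
  toRightMod : RightMod B
  /-- the left action -/
  left (S : Stonean.{u}ᵒᵖ) : Module (A.obj.obj S) (toRightMod.val.obj S)
  restr_smul {S T : Stonean.{u}ᵒᵖ} (f : S ⟶ T) (a : A.obj.obj S) (x : toRightMod.val.obj S) :
    restr toRightMod f (a • x) = (A.obj.map f).hom a • restr toRightMod f x
  smul_comm (S : Stonean.{u}ᵒᵖ) (a : A.obj.obj S) (b : (B.obj.obj S)ᵐᵒᵖ)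
    (x : toRightMod.val.obj S) : a • b • x = b • a • x

attribute [instance] Bimod.left

/-- A condensed ring `B`, as a condensed right module over itself. -/
def regular (B : CondRing.{u}) : RightMod B where
  val :=
    letI (S : Stonean.{u}ᵒᵖ) : Module ((opRing B).obj.obj S)
        ((B.obj ⋙ forget₂ RingCat.{u + 1} AddCommGrpCat.{u + 1}).obj S) :=
      inferInstanceAs (Module (B.obj.obj S)ᵐᵒᵖ (B.obj.obj S))
    PresheafOfModules.ofPresheaf (R := (opRing B).obj)
      (B.obj ⋙ forget₂ RingCat.{u + 1} AddCommGrpCat.{u + 1})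
      fun S _ f (r : (B.obj.obj S)ᵐᵒᵖ) (x : B.obj.obj S) => map_mul (B.obj.map f).hom x r.unop
  isSheaf := ((sheafCompose topo (forget₂ RingCat.{u + 1} AddCommGrpCat.{u + 1})).obj B).property

/-- A morphism of condensed rings `A ⟶ B` makes `B` an `A`-`B`-bimodule. -/
def Bimod.ofHom {A B : CondRing.{u}} (φ : A ⟶ B) : Bimod A B where
  toRightMod := regular B
  left S := inferInstanceAs (Module (A.obj.obj S)
    ((ModuleCat.restrictScalars (φ.hom.app S).hom).obj (ModuleCat.of _ (B.obj.obj S))))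
  restr_smul {S T} f a (x : B.obj.obj S) := by
    have h : (φ.hom.app T).hom ((A.obj.map f).hom a) = (B.obj.map f).hom ((φ.hom.app S).hom a) :=
      RingHom.congr_fun (congrArg RingCat.Hom.hom (φ.hom.naturality f)) a
    change (B.obj.map f).hom ((φ.hom.app S).hom a * x) =
      (φ.hom.app T).hom ((A.obj.map f).hom a) * (B.obj.map f).hom x
    rw [h, map_mul]
  smul_comm S a b (x : B.obj.obj S) :=
    (mul_assoc ((φ.hom.app S).hom a) x b.unop).symm

/-! ### Tensor products of condensed modules -/

section TensorPresheaf

variable {A B : CondRing.{u}} (M : RightMod A) (N : Bimod A B)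

/-- The right `B(S)`-module `M(S) ⊗_{A(S)} N(S)`. -/
abbrev TensorObj (S : Stonean.{u}ᵒᵖ) : Type (u + 1) :=
  BalTensor (A.obj.obj S) (B.obj.obj S) (M.val.obj S) (N.toRightMod.val.obj S)

/-- The restriction map `M(S) ⊗_{A(S)} N(S) → M(T) ⊗_{A(T)} N(T)`. -/
def tensorRestr {S T : Stonean.{u}ᵒᵖ} (f : S ⟶ T) :
    TensorObj M N S →ₛₗ[(B.obj.map f).hom.op] TensorObj M N T :=
  BalTensor.map (A.obj.map f).hom (B.obj.map f).hom.op (restr M f).toAddMonoidHom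
    (restr N.toRightMod f) (fun a m => (restr M f).map_smulₛₗ (MulOpposite.op a) m)
    (N.restr_smul f)

lemma tensorRestr_mk {S T : Stonean.{u}ᵒᵖ} (f : S ⟶ T) (n : N.toRightMod.val.obj S)
    (m : M.val.obj S) :
    tensorRestr M N f (Submodule.Quotient.mk (n ⊗ₜ[ℤ] m)) =
      Submodule.Quotient.mk (restr N.toRightMod f n ⊗ₜ[ℤ] restr M f m) := rfl

lemma tensorObj_hom_ext {S T : Stonean.{u}ᵒᵖ} {f g : TensorObj M N S →+ TensorObj M N T}
    (h : ∀ (n : N.toRightMod.val.obj S) (m : M.val.obj S),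
      f (Submodule.Quotient.mk (n ⊗ₜ[ℤ] m)) = g (Submodule.Quotient.mk (n ⊗ₜ[ℤ] m))) : f = g := by
  ext x
  obtain ⟨x, rfl⟩ := Submodule.Quotient.mk_surjective _ x
  induction x with
  | zero => simp
  | add x y hx hy => simp only [Submodule.Quotient.mk_add, map_add, hx, hy]
  | tmul n m => exact h n m

/-- The presheaf of abelian groups `S ↦ M(S) ⊗_{A(S)} N(S)`. -/
def tensorPresheafAb : Stonean.{u}ᵒᵖ ⥤ AddCommGrpCat.{u + 1} where
  obj S := AddCommGrpCat.of (TensorObj M N S)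
  map f := AddCommGrpCat.ofHom (tensorRestr M N f).toAddMonoidHom
  map_id S := by
    refine AddCommGrpCat.hom_ext (tensorObj_hom_ext M N fun n m => ?_)
    refine (tensorRestr_mk M N (𝟙 S) n m).trans ?_
    rw [restr_id, restr_id]
    rfl
  map_comp f g := by
    refine AddCommGrpCat.hom_ext (tensorObj_hom_ext M N fun n m => ?_)
    refine (tensorRestr_mk M N (f ≫ g) n m).trans ?_
    rw [restr_comp, restr_comp]
    rfl

instance (S : Stonean.{u}ᵒᵖ) :
    Module ((opRing B).obj.obj S) ((tensorPresheafAb M N).obj S) :=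
  inferInstanceAs (Module (B.obj.obj S)ᵐᵒᵖ (TensorObj M N S))

/-- The presheaf of right `B`-modules `S ↦ M(S) ⊗_{A(S)} N(S)`. -/
def tensorPresheaf : PresheafOfModules.{u + 1} (opRing B).obj :=
  PresheafOfModules.ofPresheaf (tensorPresheafAb M N)
    fun _ _ f r x => (tensorRestr M N f).map_smulₛₗ r x

/-- The tensor product `M ⊗_A N` of a condensed right `A`-module and a condensed
`A`-`B`-bimodule, a condensed right `B`-module: the sheaf associated with the presheaf
`S ↦ M(S) ⊗_{A(S)} N(S)`. (On this site the presheaf is already a sheaf, because `A`, `M` and `N`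
turn finite disjoint unions into products.) -/
def tensor : RightMod B :=
  (PresheafOfModules.sheafification (𝟙 (opRing B).obj)).obj (tensorPresheaf M N)

end TensorPresheaf

/-- The induced module `M ⊗_{R[H]} R[G]` of a right `R[H]`-module `M`, along a morphism of
condensed groups `H ⟶ G`. -/
def ind (R : CondRing.{u}) {H G : CondGrp.{u}} (i : H ⟶ G) (M : RightMod (groupRing R H)) :
    RightMod (groupRing R G) :=
  tensor M (Bimod.ofHom (groupRingMap R i))

/-! ### The bimodule `R[Hg]` -/

section Coset

variable {k l Γ Δ : Type*} [Ring k] [Ring l] [Group Γ] [Group Δ]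

/-- The group `k[Hg]` of the formal `k`-linear combinations of elements of the coset `Hg`, as a
subgroup of `k[Γ]`. -/
def cosetSpan (k : Type*) [Ring k] (H : Subgroup Γ) (g : Γ) : AddSubgroup (MonoidAlgebra k Γ) where
  carrier := {a | ∀ x ∈ a.coeff.support, x * g⁻¹ ∈ H}
  zero_mem' := by simp
  add_mem' {a b} ha hb x hx := by
    classical
    rcases Finset.mem_union.1 (Finsupp.support_add hx) with h | h
    exacts [ha x h, hb x h]
  neg_mem' {a} ha x hx := ha x (by simpa using hx)

lemma mul_mem_cosetSpan {H H' : Subgroup Γ} {g : Γ} (hH' : ∀ x ∈ H', g * x * g⁻¹ ∈ H)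
    {a b c : MonoidAlgebra k Γ} (ha : ∀ x ∈ a.coeff.support, x ∈ H) (hb : b ∈ cosetSpan k H g)
    (hc : ∀ x ∈ c.coeff.support, x ∈ H') : a * b * c ∈ cosetSpan k H g := by
  classical
  intro x hx
  obtain ⟨y, hy, z, hz, rfl⟩ := Finset.mem_mul.1 (MonoidAlgebra.support_coeff_mul_subset _ _ hx)
  obtain ⟨v, hv, w, hw, rfl⟩ := Finset.mem_mul.1 (MonoidAlgebra.support_coeff_mul_subset _ _ hy)
  have : v * w * z * g⁻¹ = v * (w * g⁻¹) * (g * z * g⁻¹) := by group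
  rw [this]
  exact H.mul_mem (H.mul_mem (ha v hv) (hb w hw)) (hH' z (hc z hz))

lemma support_monoidAlgebraMap (φ : k →+* l) (f : Γ →* Δ) (a : MonoidAlgebra k Γ) {y : Δ}
    (hy : y ∈ (monoidAlgebraMap φ f a).coeff.support) : ∃ x ∈ a.coeff.support, f x = y := by
  classical
  obtain ⟨x, hx, rfl⟩ := Finset.mem_image.1 (Finsupp.mapDomain_support hy)
  exact ⟨x, Finsupp.support_mapRange (hf := map_zero φ) hx, rfl⟩

lemma monoidAlgebraMap_mem_cosetSpan {H : Subgroup Γ} {H' : Subgroup Δ} {g : Γ} {g' : Δ}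
    (φ : k →+* l) (f : Γ →* Δ) (hf : ∀ x ∈ H, f x ∈ H') (hg : f g = g') {a : MonoidAlgebra k Γ}
    (ha : a ∈ cosetSpan k H g) : monoidAlgebraMap φ f a ∈ cosetSpan l H' g' := by
  intro y hy
  obtain ⟨x, hx, rfl⟩ := support_monoidAlgebraMap φ f a hy
  have := hf _ (ha x hx)
  rwa [map_mul, map_inv, hg] at this

/-- The inclusion `k[H] → k[Γ]` of the group ring of a subgroup. -/
abbrev subgroupRingHom (k : Type*) [Ring k] (H : Subgroup Γ) :
    MonoidAlgebra k H →+* MonoidAlgebra k Γ :=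
  monoidAlgebraMap (RingHom.id k) H.subtype

lemma subgroupRingHom_map {H : Subgroup Γ} {H' : Subgroup Δ} (φ : k →+* l) (f : Γ →* Δ)
    (f' : H →* H') (hf : ∀ x, (f' x : Δ) = f x) (a : MonoidAlgebra k H) :
    subgroupRingHom l H' (monoidAlgebraMap φ f' a) =
      monoidAlgebraMap φ f (subgroupRingHom k H a) := by
  rw [← RingHom.comp_apply, ← RingHom.comp_apply, monoidAlgebraMap_comp, monoidAlgebraMap_comp]
  have h : H'.subtype.comp f' = f.comp H.subtype := MonoidHom.ext hf
  rw [h]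
  rfl

lemma support_subgroupRingHom {H : Subgroup Γ} (a : MonoidAlgebra k H) :
    ∀ x ∈ (subgroupRingHom k H a).coeff.support, x ∈ H := by
  intro x hx
  obtain ⟨y, -, rfl⟩ := support_monoidAlgebraMap _ _ a hx
  exact y.2

lemma support_one_mem (H : Subgroup Γ) :
    ∀ x ∈ (1 : MonoidAlgebra k Γ).coeff.support, x ∈ H := by
  intro x hx
  obtain rfl : x = 1 := by simpa using MonoidAlgebra.support_coeff_one_subset hx
  exact H.one_mem

/-- The left action of `k[H]` on `k[Hg]`, by multiplication in `k[Γ]`. -/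
instance cosetSpanLeft (H : Subgroup Γ) (g : Γ) :
    Module (MonoidAlgebra k H) (cosetSpan k H g) where
  smul a b := ⟨subgroupRingHom k H a * b, by
    simpa using mul_mem_cosetSpan (H' := ⊥) (by simp) (support_subgroupRingHom a) b.2
      (support_one_mem ⊥)⟩
  one_smul b := Subtype.ext (by
    change subgroupRingHom k H 1 * (b : MonoidAlgebra k Γ) = b
    rw [map_one, one_mul])
  mul_smul a a' b := Subtype.ext (by
    change subgroupRingHom k H (a * a') * (b : MonoidAlgebra k Γ) =
      subgroupRingHom k H a * (subgroupRingHom k H a' * b)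
    rw [map_mul, mul_assoc])
  smul_zero a := Subtype.ext (mul_zero _)
  smul_add a b b' := Subtype.ext (mul_add _ _ _)
  add_smul a a' b := Subtype.ext (by
    change subgroupRingHom k H (a + a') * (b : MonoidAlgebra k Γ) =
      subgroupRingHom k H a * b + subgroupRingHom k H a' * b
    rw [map_add, add_mul])
  zero_smul b := Subtype.ext (by
    change subgroupRingHom k H 0 * (b : MonoidAlgebra k Γ) = 0
    rw [map_zero, zero_mul])

/-- The conjugate subgroup `g⁻¹ H g`. -/
abbrev conjSubgroup (H : Subgroup Γ) (g : Γ) : Subgroup Γ :=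
  H.comap (MulAut.conj g).toMonoidHom

/-- The right action of `k[g⁻¹Hg]` on `k[Hg]`, by multiplication in `k[Γ]`. -/
instance cosetSpanRight (H : Subgroup Γ) (g : Γ) :
    Module (MonoidAlgebra k (conjSubgroup H g))ᵐᵒᵖ (cosetSpan k H g) where
  smul c b := ⟨b * subgroupRingHom k (conjSubgroup H g) c.unop, by
    simpa using mul_mem_cosetSpan (H' := conjSubgroup H g) (fun x hx => hx)
      (support_one_mem H) b.2 (support_subgroupRingHom c.unop)⟩
  one_smul b := Subtype.ext (by
    change (b : MonoidAlgebra k Γ) * subgroupRingHom k (conjSubgroup H g) 1 = b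
    rw [map_one, mul_one])
  mul_smul c c' b := Subtype.ext (by
    change (b : MonoidAlgebra k Γ) * subgroupRingHom k (conjSubgroup H g) (c'.unop * c.unop) =
      b * subgroupRingHom k _ c'.unop * subgroupRingHom k _ c.unop
    rw [map_mul, mul_assoc])
  smul_zero c := Subtype.ext (zero_mul _)
  smul_add c b b' := Subtype.ext (add_mul _ _ _)
  add_smul c c' b := Subtype.ext (by
    change (b : MonoidAlgebra k Γ) * subgroupRingHom k (conjSubgroup H g) (c.unop + c'.unop) =
      b * subgroupRingHom k _ c.unop + b * subgroupRingHom k _ c'.unop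
    rw [map_add, mul_add])
  zero_smul b := Subtype.ext (by
    change (b : MonoidAlgebra k Γ) * subgroupRingHom k (conjSubgroup H g) 0 = 0
    rw [map_zero, mul_zero])

lemma coe_smul_cosetSpan {H : Subgroup Γ} {g : Γ} (a : MonoidAlgebra k H) (b : cosetSpan k H g) :
    ((a • b : cosetSpan k H g) : MonoidAlgebra k Γ) = subgroupRingHom k H a * b := rfl

lemma coe_op_smul_cosetSpan {H : Subgroup Γ} {g : Γ} (c : (MonoidAlgebra k (conjSubgroup H g))ᵐᵒᵖ)
    (b : cosetSpan k H g) : ((c • b : cosetSpan k H g) : MonoidAlgebra k Γ) =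
      b * subgroupRingHom k (conjSubgroup H g) c.unop := rfl

lemma coset_smul_comm {H : Subgroup Γ} {g : Γ} (a : MonoidAlgebra k H)
    (c : (MonoidAlgebra k (conjSubgroup H g))ᵐᵒᵖ) (b : cosetSpan k H g) :
    a • c • b = c • a • b :=
  Subtype.ext (mul_assoc (subgroupRingHom k H a) (b : MonoidAlgebra k Γ) _).symm

end Coset

section CosetSheaf

variable (R : CondRing.{u}) {G : CondGrp.{u}} (H : CondSubgroup G) (g : CondGrp.underlying G)

/-- The restriction map `R(S)[H(S)g] → R(T)[H(T)g]`. -/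
def cosetRestr {S T : Stonean.{u}ᵒᵖ} (f : S ⟶ T) :
    cosetSpan (R.obj.obj S) (H.obj S) (CondGrp.const G g S) →+
      cosetSpan (R.obj.obj T) (H.obj T) (CondGrp.const G g T) :=
  ((monoidAlgebraMap (R.obj.map f).hom (G.obj.map f).hom).toAddMonoidHom.comp
    (cosetSpan (R.obj.obj S) (H.obj S) (CondGrp.const G g S)).subtype).codRestrict
      (cosetSpan (R.obj.obj T) (H.obj T) (CondGrp.const G g T)) fun x => monoidAlgebraMap_mem_cosetSpan (R.obj.map f).hom (G.obj.map f).hom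
      (fun _ hx => H.map_mem f hx) (CondGrp.map_const G g f) x.2

lemma coe_cosetRestr {S T : Stonean.{u}ᵒᵖ} (f : S ⟶ T)
    (x : cosetSpan (R.obj.obj S) (H.obj S) (CondGrp.const G g S)) :
    (cosetRestr R H g f x : MonoidAlgebra (R.obj.obj T) (G.obj.obj T)) =
      monoidAlgebraMap (R.obj.map f).hom (G.obj.map f).hom x := rfl

lemma cosetRestr_id {S : Stonean.{u}ᵒᵖ}
    (x : cosetSpan (R.obj.obj S) (H.obj S) (CondGrp.const G g S)) :
    cosetRestr R H g (𝟙 S) x = x := by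
  refine Subtype.ext ((coe_cosetRestr R H g (𝟙 S) x).trans ?_)
  exact RingHom.congr_fun (congrArg RingCat.Hom.hom ((groupRingPresheaf R G).map_id S)) x.1

lemma cosetRestr_comp {S T U : Stonean.{u}ᵒᵖ} (f : S ⟶ T) (f' : T ⟶ U)
    (x : cosetSpan (R.obj.obj S) (H.obj S) (CondGrp.const G g S)) :
    cosetRestr R H g (f ≫ f') x = cosetRestr R H g f' (cosetRestr R H g f x) := by
  refine Subtype.ext ((coe_cosetRestr R H g (f ≫ f') x).trans ?_)
  exact RingHom.congr_fun (congrArg RingCat.Hom.hom ((groupRingPresheaf R G).map_comp f f')) x.1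

/-- The presheaf of abelian groups `S ↦ R(S)[H(S)g]`. -/
def cosetPresheaf : Stonean.{u}ᵒᵖ ⥤ AddCommGrpCat.{u + 1} where
  obj S := AddCommGrpCat.of (cosetSpan (R.obj.obj S) (H.obj S) (CondGrp.const G g S))
  map f := AddCommGrpCat.ofHom (cosetRestr R H g f)
  map_id _ := AddCommGrpCat.hom_ext (AddMonoidHom.ext fun x => cosetRestr_id R H g x)
  map_comp f f' := AddCommGrpCat.hom_ext (AddMonoidHom.ext fun x => cosetRestr_comp R H g f f' x)

instance (S : Stonean.{u}ᵒᵖ) : Module ((groupRingPresheaf R H.toCondGrp).obj S)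
    ((cosetPresheaf R H g).obj S) :=
  inferInstanceAs (Module (MonoidAlgebra (R.obj.obj S) (H.obj S))
    (cosetSpan (R.obj.obj S) (H.obj S) (CondGrp.const G g S)))

instance (S : Stonean.{u}ᵒᵖ) :
    Module ((opPresheaf (groupRingPresheaf R (H.conj g).toCondGrp)).obj S)
      ((cosetPresheaf R H g).obj S) :=
  inferInstanceAs
    (Module (MonoidAlgebra (R.obj.obj S) (conjSubgroup (H.obj S) (CondGrp.const G g S)))ᵐᵒᵖ
      (cosetSpan (R.obj.obj S) (H.obj S) (CondGrp.const G g S)))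

/-- The presheaf `S ↦ R(S)[H(S)g]`, as a presheaf of left modules over `S ↦ R(S)[H(S)]`. -/
def cosetLeft : PresheafOfModules.{u + 1} (groupRingPresheaf R H.toCondGrp) :=
  PresheafOfModules.ofPresheaf (cosetPresheaf R H g)
    fun S T f (a : MonoidAlgebra (R.obj.obj S) (H.obj S))
      (b : cosetSpan (R.obj.obj S) (H.obj S) (CondGrp.const G g S)) => Subtype.ext (by
    change monoidAlgebraMap (R.obj.map f).hom (G.obj.map f).hom
        (subgroupRingHom (R.obj.obj S) (H.obj S) a * b.1) =
      subgroupRingHom (R.obj.obj T) (H.obj T)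
          (monoidAlgebraMap (R.obj.map f).hom (H.restr f) a) *
        monoidAlgebraMap (R.obj.map f).hom (G.obj.map f).hom b.1
    rw [map_mul, subgroupRingHom_map (R.obj.map f).hom (G.obj.map f).hom
      (H.restr f) (fun _ => rfl)])

/-- The presheaf `S ↦ R(S)[H(S)g]`, as a presheaf of right modules over
`S ↦ R(S)[(g⁻¹Hg)(S)]`. -/
def cosetRight :
    PresheafOfModules.{u + 1} (opPresheaf (groupRingPresheaf R (H.conj g).toCondGrp)) :=
  PresheafOfModules.ofPresheaf (cosetPresheaf R H g)
    fun S T f (c : (MonoidAlgebra (R.obj.obj S) ((H.conj g).obj S))ᵐᵒᵖ)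
      (b : cosetSpan (R.obj.obj S) (H.obj S) (CondGrp.const G g S)) => Subtype.ext (by
    change monoidAlgebraMap (R.obj.map f).hom (G.obj.map f).hom
        (b.1 * subgroupRingHom (R.obj.obj S) ((H.conj g).obj S) c.unop) =
      monoidAlgebraMap (R.obj.map f).hom (G.obj.map f).hom b.1 *
        subgroupRingHom (R.obj.obj T) ((H.conj g).obj T)
          (monoidAlgebraMap (R.obj.map f).hom ((H.conj g).restr f) c.unop)
    rw [map_mul, subgroupRingHom_map (R.obj.map f).hom (G.obj.map f).hom
      ((H.conj g).restr f) (fun _ => rfl)])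

/-- The morphism from the opposite of the presheaf of group rings to the opposite of `R[G]`. -/
abbrev toGroupRingOp (R : CondRing.{u}) (G : CondGrp.{u}) :
    opPresheaf (groupRingPresheaf R G) ⟶ (opRing (groupRing R G)).obj :=
  opPresheafMap (toGroupRing R G)

instance (R : CondRing.{u}) (G : CondGrp.{u}) :
    Presheaf.IsLocallyInjective topo (toGroupRingOp R G) where
  equalizerSieve_mem {S} x y h := by
    refine topo.superset_covering ?_ (Presheaf.equalizerSieve_mem topo (toGroupRing R G)
      (MulOpposite.unop x) (MulOpposite.unop y) (congrArg MulOpposite.unop h))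
    intro T f hf
    exact congrArg MulOpposite.op hf

instance (R : CondRing.{u}) (G : CondGrp.{u}) :
    Presheaf.IsLocallySurjective topo (toGroupRingOp R G) where
  imageSieve_mem {S} x := by
    refine topo.superset_covering ?_ (Presheaf.imageSieve_mem topo (toGroupRing R G)
      (MulOpposite.unop x))
    rintro T f ⟨y, hy⟩
    exact ⟨MulOpposite.op y, congrArg MulOpposite.op hy⟩

/-- The `R[H]`-`R[g⁻¹Hg]`-bimodule `R[Hg]`: the sheafification of `S ↦ R(S)[H(S)g]`, with its left
and right actions. -/
def cosetBimod : Bimod (groupRing R H.toCondGrp) (groupRing R (H.conj g).toCondGrp) where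
  toRightMod := (PresheafOfModules.sheafification (toGroupRingOp R (H.conj g).toCondGrp)).obj
    (cosetRight R H g)
  left S := inferInstanceAs (Module ((groupRing R H.toCondGrp).obj.obj S)
    (((PresheafOfModules.sheafification (toGroupRing R H.toCondGrp)).obj
      (cosetLeft R H g)).val.obj S))
  restr_smul f a x :=
    ((PresheafOfModules.sheafification (toGroupRing R H.toCondGrp)).obj
      (cosetLeft R H g)).val.map_smul f a x
  smul_comm S a b x := by
    let A := (presheafToSheaf topo AddCommGrpCat.{u + 1}).obj (cosetPresheaf R H g)
    let φl := toSheafify topo (cosetLeft R H g).presheaf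
    let φr := toSheafify topo (cosetRight R H g).presheaf
    let α := toGroupRing R H.toCondGrp
    let β := toGroupRingOp R (H.conj g).toCondGrp
    let b' : (opRing (groupRing R (H.conj g).toCondGrp)).obj.obj S := b
    let x' : A.obj.obj S := x
    have key : PresheafOfModules.Sheafify.smul α φl a (PresheafOfModules.Sheafify.smul β φr b' x') =
        PresheafOfModules.Sheafify.smul β φr b' (PresheafOfModules.Sheafify.smul α φl a x') := by
      refine A.isSeparated _ _ (topo.intersection_covering (topo.intersection_covering
        (Presheaf.imageSieve_mem topo α a) (Presheaf.imageSieve_mem topo β b'))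
        (Presheaf.imageSieve_mem topo φl x')) _ _ ?_
      rintro T f ⟨⟨⟨(a₀ : (groupRingPresheaf R H.toCondGrp).obj (op T)), ha₀⟩,
        ⟨(b₀ : (opPresheaf (groupRingPresheaf R (H.conj g).toCondGrp)).obj (op T)), hb₀⟩⟩,
        ⟨(x₀ : (cosetLeft R H g).obj (op T)), hx₀⟩⟩
      let xr : (cosetRight R H g).obj (op T) := x₀
      let ax : (cosetRight R H g).obj (op T) := (a₀ • x₀ : (cosetLeft R H g).obj (op T))
      let bx : (cosetLeft R H g).obj (op T) := (b₀ • xr : (cosetRight R H g).obj (op T))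
      have hx₁ : φr.app (op T) xr = A.obj.map f.op x' := hx₀
      have h₁ := PresheafOfModules.Sheafify.map_smul_eq α φl a
        (PresheafOfModules.Sheafify.smul β φr b' x') f.op a₀ ha₀ bx
        (PresheafOfModules.Sheafify.map_smul_eq β φr b' x' f.op b₀ hb₀ xr hx₁).symm
      have h₂ := PresheafOfModules.Sheafify.map_smul_eq β φr b'
        (PresheafOfModules.Sheafify.smul α φl a x') f.op b₀ hb₀ ax
        (PresheafOfModules.Sheafify.map_smul_eq α φl a x' f.op a₀ ha₀ x₀ hx₀).symm
      refine h₁.trans (Eq.trans ?_ h₂.symm)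
      exact congrArg (φl.app (op T)) (coset_smul_comm
        (a₀ : MonoidAlgebra (R.obj.obj (op T)) (H.obj (op T)))
        (b₀ : (MonoidAlgebra (R.obj.obj (op T))
          (conjSubgroup (H.obj (op T)) (CondGrp.const G g (op T))))ᵐᵒᵖ)
        (x₀ : cosetSpan (R.obj.obj (op T)) (H.obj (op T)) (CondGrp.const G g (op T))))
    exact key

end CosetSheaf

/-- `Res` to `K ∩ g⁻¹Hg` and `Ind` to `K` of the right `R[g⁻¹Hg]`-module `M ⊗_{R[H]} R[Hg]`. -/
def mackeyTerm (R : CondRing.{u}) {G : CondGrp.{u}} (H K : CondSubgroup G)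
    (M : RightMod (groupRing R H.toCondGrp)) (g : CondGrp.underlying G) :
    RightMod (groupRing R K.toCondGrp) :=
  ind R (CondSubgroup.inclOfLE (CondSubgroup.inf_le_left K (H.conj g)))
    ((res (groupRingMap R (CondSubgroup.inclOfLE (CondSubgroup.inf_le_right K (H.conj g))))).obj
      (tensor M (cosetBimod R H g)))

end

end CondMackey

open CondMackey

namespace CondMackey

noncomputable section

section

/-! ### Coverings of extremally disconnected spaces -/

/-! The restricted induced module is shown to have the universal property of the coproduct of the
Mackey terms, so no description of the sections of an infinite direct sum of sheaves is needed. The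
candidate coprojections are `mackeyHom`, given by `(m ⊗ n) ⊗ 1 ↦ m ⊗ n` with `R[Hg]` mapped to
`R[G]`.

Openness enters once, in `decompSieve_mem`. Let `x` be a section of `G` over `S`, let `s` be a point
of `S`, and let `g` be the value of `x` at `s`. Then `x g⁻¹` and `g⁻¹ x` are trivial at `s`, so if
`H` is open the first lies in `H` on a clopen neighbourhood of `s`, and if `K` is open the second
lies in `K` on one. Either way `x` is locally of the form `h g k` with `g` constant, and `g` may be
replaced by the representative of its double coset. Over a nonempty space the double coset is
determined by `x`, as evaluation at a point shows (`doubleCoset_eq`). Thus every section of `G`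
splits locally, in an essentially unique way, into pieces lying in the `H g K`.

A map out of the restricted induced module amounts to a natural map `b(m, x)`, the image of `m ⊗ x`,
which is additive in `m`, balanced over `H` and compatible with `K` and the scalars. By the local
splitting it is determined by the maps `δ_g(m) = b(m, g)`, through `b(m, h g k) = δ_g(m h) k`. This
formula is well defined as soon as `δ_g(m h) = δ_g(m) k` whenever `h g = g k`, which is the
condition in `TwistedHom`. A morphism out of the Mackey term of `g` yields such a `δ_g` by
restriction to the sections `(m ⊗ g) ⊗ 1` (`mackeyMk_act_cosetGen`), and these sections determine it
(`mackeyTerm_hom_ext`). Gluing the formula over the local splittings gives existence in the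
universal property (`exists_mackey_desc`); the same splitting gives uniqueness (`mackey_hom_ext`).

The remaining work is to define and compare maps out of sheafified tensor products by looking only
at sections `m ⊗ n` with `n` in the unsheafified presheaf. This rests on `exists_natAddHom_tensor`,
`exists_extension` and the local generation statement `tmk_locally_generates`. -/

/-- Since `V` is closed, closures in `V` are preimages of closures in `X`; since `V` is open, an
open subset of `V` is open in `X`, where its closure is open. -/
lemma extremallyDisconnected_of_isClopen {X : Type*} [TopologicalSpace X]
    [ExtremallyDisconnected X] {V : Set X} (hV : IsClopen V) : ExtremallyDisconnected V :=
  ⟨fun U hU => by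
    rw [← (closure U).preimage_image_eq Subtype.coe_injective,
      ← hV.1.isClosedEmbedding_subtypeVal.closure_image_eq U]
    exact isOpen_induced (ExtremallyDisconnected.open_closure _
      (hV.2.isOpenEmbedding_subtypeVal.isOpenMap U hU))⟩

/-- A clopen subset of an extremally disconnected compact Hausdorff space. -/
def clopen (S : Stonean.{u}) (V : Set S) (hV : IsClopen V) : Stonean.{u} :=
  { toTop := TopCat.of V
    is_compact := isCompact_iff_compactSpace.1 hV.1.isCompact
    is_hausdorff := inferInstanceAs (T2Space V)
    prop := extremallyDisconnected_of_isClopen hV }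

/-- The inclusion of a clopen subset. -/
def clopenIncl (S : Stonean.{u}) (V : Set S) (hV : IsClopen V) : clopen S V hV ⟶ S :=
  ConcreteCategory.ofHom (C := Stonean.{u}) (⟨Subtype.val, continuous_subtype_val⟩ : C(V, S))

lemma clopenIncl_mem (S : Stonean.{u}) (V : Set S) (hV : IsClopen V) (t : clopen S V hV) :
    clopenIncl S V hV t ∈ V := Subtype.property (p := fun x => x ∈ V) t

lemma exists_clopenIncl_eq (S : Stonean.{u}) (V : Set S) (hV : IsClopen V) {s : S} (hs : s ∈ V) :
    ∃ t : clopen S V hV, clopenIncl S V hV t = s := ⟨(⟨s, hs⟩ : V), rfl⟩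

/-- The point `s` of `S`, as a morphism. -/
def pointMap (S : Stonean.{u}) (s : S) : pt.{u} ⟶ S :=
  CompHausLike.ofHom _ ⟨fun _ => s, continuous_const⟩

lemma toPt_pt : toPt pt.{u} = 𝟙 _ := CompHausLike.isTerminalPUnit.hom_ext _ _

/-- A sieve is a covering as soon as it contains a clopen neighbourhood of every point. -/
lemma mem_topo_of_clopen {S : Stonean.{u}} (C : Sieve S)
    (h : ∀ s : S, ∃ (V : Set S) (hV : IsClopen V), s ∈ V ∧ C (clopenIncl S V hV)) :
    C ∈ topo S := by
  choose V hV hs hC using h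
  obtain ⟨t, ht⟩ := isCompact_univ.elim_finite_subcover V (fun s => (hV s).2)
    (fun s _ => Set.mem_iUnion.2 ⟨s, hs s⟩)
  -- The finite subcover is indexed by points of `S`, which live in `Type u`; it is reindexed by
  -- `Fin` because covering families of the coherent topology are indexed by a finite type in
  -- `Type`.
  refine coherentTopology.mem_sieves_of_hasEffectiveEpiFamily C
    ⟨Fin t.card, inferInstance, fun i => clopen S _ (hV (t.equivFin.symm i).1),
      fun i => clopenIncl S _ (hV (t.equivFin.symm i).1), ?_, fun i => hC _⟩
  refine Stonean.effectiveEpiFamily_of_jointly_surjective _ _ fun b => ?_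
  obtain ⟨s, hst, hb⟩ := Set.mem_iUnion₂.1 (ht (Set.mem_univ b))
  refine ⟨t.equivFin ⟨s, hst⟩, exists_clopenIncl_eq S _ _ ?_⟩
  simpa using hb

lemma exists_clopen_subset {S : Stonean.{u}} {U : Set S} (hU : IsOpen U) {s : S} (hs : s ∈ U) :
    ∃ V : Set S, IsClopen V ∧ s ∈ V ∧ V ⊆ U :=
  compact_exists_isClopen_in_isOpen hU hs

/-- The empty family is jointly surjective onto the empty space. Hence all sections of a sheaf over
it agree. -/
lemma bot_mem_topo {S : Stonean.{u}} [IsEmpty S] : (⊥ : Sieve S) ∈ topo S :=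
  mem_topo_of_clopen _ fun s => isEmptyElim s

/-! ### Gluing sections of condensed modules -/

namespace RightMod

variable {A : CondRing.{u}} (X : RightMod A)

lemma restr_op_comp {S T U : Stonean.{u}} (f : T ⟶ S) (g : U ⟶ T) (x : X.val.obj (op S)) :
    restr X (g ≫ f).op x = restr X g.op (restr X f.op x) :=
  restr_comp X f.op g.op x

lemma ext_of_cover {S : Stonean.{u}} {C : Sieve S} (hC : C ∈ topo S) {x y : X.val.obj (op S)}
    (h : ∀ ⦃T : Stonean.{u}⦄ (f : T ⟶ S), C f → restr X f.op x = restr X f.op y) : x = y :=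
  X.isSheaf.isSeparated _ C hC x y h

/-- Gluing for local values that depend on auxiliary choices (lifts, decompositions). They are
encoded by a relation which is stable under restriction and single-valued, so that any family of
choices is compatible. The result restricts correctly along every map where `r` has a value, not
only along those of the cover. -/
lemma exists_glue {S : Stonean.{u}} (r : ∀ ⦃T : Stonean.{u}⦄, (T ⟶ S) → X.val.obj (op T) → Prop)
    (hres : ∀ ⦃T U : Stonean.{u}⦄ (f : T ⟶ S) (g : U ⟶ T) (p : X.val.obj (op T)), r f p →
      r (g ≫ f) (restr X g.op p))
    (huniq : ∀ ⦃T : Stonean.{u}⦄ (f : T ⟶ S) (p q : X.val.obj (op T)), r f p → r f q → p = q)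
    {C : Sieve S} (hC : C ∈ topo S)
    (hcov : ∀ ⦃T : Stonean.{u}⦄ (f : T ⟶ S), C f → ∃ p, r f p) :
    ∃ p : X.val.obj (op S), ∀ ⦃T : Stonean.{u}⦄ (f : T ⟶ S) (q : X.val.obj (op T)), r f q →
      restr X f.op p = q := by
  choose p hp using hcov
  have hsh := (isSheaf_iff_isSheaf_of_type _ _).1
    ((Presheaf.isSheaf_iff_isSheaf_forget topo X.val.presheaf (forget _)).1 X.isSheaf)
  let fam : Presieve.FamilyOfElements (X.val.presheaf ⋙ forget AddCommGrpCat.{u + 1}) C.arrows :=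
    fun T f hf => p f hf
  have hfam : fam.Compatible := by
    intro Y₁ Y₂ Z g₁ g₂ f₁ f₂ h₁ h₂ e
    have h₃ := hres f₁ g₁ _ (hp f₁ h₁)
    rw [e] at h₃
    exact huniq _ _ _ h₃ (hres f₂ g₂ _ (hp f₂ h₂))
  obtain ⟨a, ha⟩ : ∃ a : X.val.obj (op S), ∀ ⦃T : Stonean.{u}⦄ (f : T ⟶ S) (hf : C f),
      restr X f.op a = p f hf := (hsh C hC fam hfam).exists
  refine ⟨a, fun T f q hq => ?_⟩
  -- The map `f` need not belong to `C`, so the comparison is made on the pullback of `C` along `f`.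
  refine ext_of_cover X (topo.pullback_stable f hC) fun U g hg => ?_
  rw [← restr_op_comp, ha _ hg]
  exact huniq _ _ _ (hp _ hg) (hres f g q hq)

lemma subsingleton_of_isEmpty {S : Stonean.{u}} [IsEmpty S] (x y : X.val.obj (op S)) : x = y :=
  ext_of_cover X bot_mem_topo fun _ _ h => h.elim

end RightMod

end

section

/-! ### Additive maps of condensed modules -/

/-- A natural family of additive maps between the sections of two condensed modules, possibly over
different condensed rings. -/
structure NatAddHom {A B : CondRing.{u}} (X : RightMod A) (Y : RightMod B) where
  /-- the additive map on the sections over `S` -/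
  app (S : Stonean.{u}ᵒᵖ) : X.val.obj S →+ Y.val.obj S
  naturality {S T : Stonean.{u}ᵒᵖ} (f : S ⟶ T) (x : X.val.obj S) :
    app T (restr X f x) = restr Y f (app S x)

/-- A natural family of additive maps which commute with the scalars is a morphism. -/
def NatAddHom.toHom {A : CondRing.{u}} {X Y : RightMod A} (φ : NatAddHom X Y)
    (h : ∀ (S : Stonean.{u}ᵒᵖ) (a : A.obj.obj S) (x : X.val.obj S),
      φ.app S (MulOpposite.op a • x) = MulOpposite.op a • φ.app S x) : X ⟶ Y where
  val := PresheafOfModules.homMk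
    { app S := AddCommGrpCat.ofHom (φ.app S)
      naturality _ _ f := AddCommGrpCat.hom_ext (AddMonoidHom.ext fun x => φ.naturality f x) }
    fun S r x => h S (MulOpposite.unop r) x

/-- The natural family of additive maps underlying a morphism. -/
def NatAddHom.ofHom {A : CondRing.{u}} {X Y : RightMod A} (φ : X ⟶ Y) : NatAddHom X Y where
  app S := (φ.val.app S).hom.toAddMonoidHom
  naturality f x := PresheafOfModules.naturality_apply φ.val f x

lemma RightMod.hom_map_smul {A : CondRing.{u}} {X Y : RightMod A} (φ : X ⟶ Y)
    {S : Stonean.{u}ᵒᵖ} (a : A.obj.obj S) (x : X.val.obj S) :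
    φ.val.app S (MulOpposite.op a • x) = MulOpposite.op a • (φ.val.app S x : Y.val.obj S) :=
  (φ.val.app S).hom.map_smul (MulOpposite.op a) x

lemma RightMod.hom_restr {A : CondRing.{u}} {X Y : RightMod A} (φ : X ⟶ Y)
    {S T : Stonean.{u}ᵒᵖ} (f : S ⟶ T) (x : X.val.obj S) :
    φ.val.app T (restr X f x) = restr Y f (φ.val.app S x) :=
  PresheafOfModules.naturality_apply φ.val f x

lemma RightMod.restr_smul {A : CondRing.{u}} (X : RightMod A) {S T : Stonean.{u}ᵒᵖ} (f : S ⟶ T)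
    (a : A.obj.obj S) (x : X.val.obj S) :
    restr X f (MulOpposite.op a • x) =
      MulOpposite.op ((A.obj.map f).hom a) • restr X f x :=
  (restr X f).map_smulₛₗ (MulOpposite.op a) x

/-! ### Maps out of tensor products -/

section Tensor

variable {A B : CondRing.{u}} (M : RightMod A) (N : Bimod A B)

/-- The section `m ⊗ n` of `M ⊗_A N`. -/
def tmk {S : Stonean.{u}ᵒᵖ} (m : M.val.obj S) (n : N.toRightMod.val.obj S) :
    (tensor M N).val.obj S :=
  ((toSheafify topo (tensorPresheafAb M N)).app S).hom (Submodule.Quotient.mk (n ⊗ₜ[ℤ] m))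

lemma tmk_add_left {S : Stonean.{u}ᵒᵖ} (m m' : M.val.obj S) (n : N.toRightMod.val.obj S) :
    tmk M N (m + m') n = tmk M N m n + tmk M N m' n := by
  refine Eq.trans ?_ (map_add ((toSheafify topo (tensorPresheafAb M N)).app S).hom _ _)
  exact congrArg _ (congrArg Submodule.Quotient.mk (TensorProduct.tmul_add n m m'))

lemma tmk_add_right {S : Stonean.{u}ᵒᵖ} (m : M.val.obj S) (n n' : N.toRightMod.val.obj S) :
    tmk M N m (n + n') = tmk M N m n + tmk M N m n' := by
  refine Eq.trans ?_ (map_add ((toSheafify topo (tensorPresheafAb M N)).app S).hom _ _)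
  exact congrArg _ (congrArg Submodule.Quotient.mk (TensorProduct.add_tmul n n' m))

/-- The biadditive map `(m, n) ↦ m ⊗ n`. -/
def tmkHom (S : Stonean.{u}ᵒᵖ) :
    M.val.obj S →+ N.toRightMod.val.obj S →+ (tensor M N).val.obj S :=
  AddMonoidHom.mk' (fun m => AddMonoidHom.mk' (fun n => tmk M N m n) (tmk_add_right M N m))
    fun m m' => AddMonoidHom.ext fun n => tmk_add_left M N m m' n

lemma tmk_smul_left {S : Stonean.{u}ᵒᵖ} (m : M.val.obj S) (a : A.obj.obj S)
    (n : N.toRightMod.val.obj S) :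
    tmk M N (MulOpposite.op a • m) n = tmk M N m (a • n) := by
  refine congrArg ((toSheafify topo (tensorPresheafAb M N)).app S).hom ?_
  refine ((Submodule.Quotient.eq _).2 ?_).symm
  exact Submodule.subset_span ⟨n, a, m, rfl⟩

lemma restr_tmk {S T : Stonean.{u}ᵒᵖ} (f : S ⟶ T) (m : M.val.obj S)
    (n : N.toRightMod.val.obj S) :
    restr (tensor M N) f (tmk M N m n) = tmk M N (restr M f m) (restr N.toRightMod f n) :=
  (ConcreteCategory.congr_hom ((toSheafify topo (tensorPresheafAb M N)).naturality f)
    (Submodule.Quotient.mk (n ⊗ₜ[ℤ] m))).symm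

/-- The unit of the sheafification of modules is linear, and on the presheaf `B(S)` acts through the
factor `N(S)`. -/
lemma smul_tmk {S : Stonean.{u}ᵒᵖ} (b : B.obj.obj S) (m : M.val.obj S)
    (n : N.toRightMod.val.obj S) :
    MulOpposite.op b • tmk M N m n = tmk M N m (MulOpposite.op b • n) := by
  have h := (((PresheafOfModules.toSheafify (𝟙 (opRing B).obj)
    (toSheafify topo (tensorPresheaf M N).presheaf)).app S).hom.map_smul (MulOpposite.op b)
      (Submodule.Quotient.mk (n ⊗ₜ[ℤ] m) : TensorObj M N S)).symm
  exact h

/-- Sections of a sheafification come locally from the presheaf, and `M(T) ⊗ N(T)` is additively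
generated by the pure tensors. -/
lemma tmk_locally_generates {S : Stonean.{u}} (t : (tensor M N).val.obj (op S)) :
    ∃ C ∈ topo S, ∀ ⦃T : Stonean.{u}⦄ (f : T ⟶ S), C f → restr (tensor M N) f.op t ∈
      AddSubgroup.closure {x | ∃ m n, x = tmk M N (S := op T) m n} := by
  refine ⟨_, Presheaf.imageSieve_mem topo (toSheafify topo (tensorPresheafAb M N)) t, ?_⟩
  rintro T f ⟨(x : TensorObj M N (op T)), hx⟩
  let τ : TensorObj M N (op T) →+ (tensor M N).val.obj (op T) :=
    ((toSheafify topo (tensorPresheafAb M N)).app (op T)).hom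
  have hx' : τ x = restr (tensor M N) f.op t := hx
  rw [← hx']
  clear hx hx'
  obtain ⟨x, rfl⟩ := Submodule.Quotient.mk_surjective _ x
  induction x with
  | zero => rw [Submodule.Quotient.mk_zero, map_zero]; exact zero_mem _
  | add x y hx hy => rw [Submodule.Quotient.mk_add, map_add]; exact add_mem hx hy
  | tmul n m => exact AddSubgroup.subset_closure ⟨m, n, rfl⟩

variable {M N}

/-- The sections on which two additive maps agree form a subgroup, and agreement is a local
property, so `tmk_locally_generates` applies. -/
lemma NatAddHom.ext_tmk {D : CondRing.{u}} {Q : RightMod D} {F F' : NatAddHom (tensor M N) Q}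
    (h : ∀ S m n, F.app S (tmk M N m n) = F'.app S (tmk M N m n)) (S : Stonean.{u}ᵒᵖ)
    (t : (tensor M N).val.obj S) : F.app S t = F'.app S t := by
  obtain ⟨C, hC, hg⟩ := tmk_locally_generates M N (S := S.unop) t
  refine RightMod.ext_of_cover Q hC fun T f hf => ?_
  refine (F.naturality f.op t).symm.trans (Eq.trans ?_ (F'.naturality f.op t))
  have : AddSubgroup.closure {x | ∃ m n, x = tmk M N (S := op T) m n} ≤
      AddMonoidHom.eqLocus (F.app (op T)) (F'.app (op T)) := by
    rw [AddSubgroup.closure_le]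
    rintro _ ⟨m, n, rfl⟩
    exact h _ m n
  exact this (hg f hf)

/-- Compatibility with scalars may be checked on the sections `m ⊗ n`. -/
lemma NatAddHom.map_smul_of_tmk {D : CondRing.{u}} {Q : RightMod D} (F : NatAddHom (tensor M N) Q)
    {S : Stonean.{u}} (b : B.obj.obj (op S)) (d : D.obj.obj (op S))
    (h : ∀ ⦃T : Stonean.{u}⦄ (f : T ⟶ S) (m : M.val.obj (op T))
      (n : N.toRightMod.val.obj (op T)),
      F.app (op T) (tmk M N m (MulOpposite.op ((B.obj.map f.op).hom b) • n)) =
        MulOpposite.op ((D.obj.map f.op).hom d) • F.app (op T) (tmk M N m n))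
    (t : (tensor M N).val.obj (op S)) :
    F.app (op S) (MulOpposite.op b • t) = MulOpposite.op d • F.app (op S) t := by
  obtain ⟨C, hC, hg⟩ := tmk_locally_generates M N t
  refine RightMod.ext_of_cover Q hC fun T f hf => ?_
  refine (F.naturality f.op _).symm.trans ?_
  rw [RightMod.restr_smul, RightMod.restr_smul, ← F.naturality]
  have : AddSubgroup.closure {x | ∃ m n, x = tmk M N (S := op T) m n} ≤
      AddMonoidHom.eqLocus
        ((F.app (op T)).comp (DistribSMul.toAddMonoidHom _
          (MulOpposite.op ((B.obj.map f.op).hom b))))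
        ((DistribSMul.toAddMonoidHom _ (MulOpposite.op ((D.obj.map f.op).hom d))).comp
          (F.app (op T))) := by
    rw [AddSubgroup.closure_le]
    rintro _ ⟨m, n, rfl⟩
    exact (congrArg _ (smul_tmk M N _ m n)).trans (h f m n)
  exact this (hg f hf)

/-- The universal property of the tensor product. -/
lemma exists_natAddHom_tensor {D : CondRing.{u}} {Q : RightMod D}
    (β : ∀ S, M.val.obj S →+ N.toRightMod.val.obj S →+ Q.val.obj S)
    (hnat : ∀ {S T : Stonean.{u}ᵒᵖ} (f : S ⟶ T) (m : M.val.obj S) (n : N.toRightMod.val.obj S),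
      β T (restr M f m) (restr N.toRightMod f n) = restr Q f (β S m n))
    (hbal : ∀ (S : Stonean.{u}ᵒᵖ) (m : M.val.obj S) (a : A.obj.obj S)
      (n : N.toRightMod.val.obj S), β S (MulOpposite.op a • m) n = β S m (a • n)) :
    ∃ F : NatAddHom (tensor M N) Q, ∀ S m n, F.app S (tmk M N m n) = β S m n := by
  let γ (S : Stonean.{u}ᵒᵖ) : N.toRightMod.val.obj S ⊗[ℤ] M.val.obj S →+ Q.val.obj S :=
    TensorProduct.liftAddHom (β S).flip fun r n m => by
      simp only [AddMonoidHom.flip_apply, map_zsmul, AddMonoidHom.zsmul_apply]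
  have hγ (S : Stonean.{u}ᵒᵖ) (n : N.toRightMod.val.obj S) (m : M.val.obj S) :
      γ S (n ⊗ₜ m) = β S m n := rfl
  -- The relations form a `B`-span whereas `γ` is only additive, so the induction needs the stronger
  -- claim for all multiples `b • z`. On a generator it holds because the actions of `A` and `B` on
  -- `N` commute.
  have hker (S : Stonean.{u}ᵒᵖ) (z : N.toRightMod.val.obj S ⊗[ℤ] M.val.obj S)
      (hz : z ∈ tensorRel (A.obj.obj S) (B.obj.obj S) (M.val.obj S) (N.toRightMod.val.obj S)) :
      ∀ b : (B.obj.obj S)ᵐᵒᵖ, γ S (b • z) = 0 := by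
    induction hz using Submodule.span_induction with
    | mem z hz =>
      obtain ⟨n, a, m, rfl⟩ := hz
      intro b
      rw [smul_sub, TensorProduct.smul_tmul', TensorProduct.smul_tmul', map_sub, hγ, hγ, hbal,
        N.smul_comm, sub_self]
    | zero => intro b; rw [smul_zero, map_zero]
    | add x y _ _ hx hy => intro b; rw [smul_add, map_add, hx, hy, add_zero]
    | smul c x _ hx => intro b; rw [← mul_smul, hx]
  let δ (S : Stonean.{u}ᵒᵖ) : TensorObj M N S →+ Q.val.obj S :=
    QuotientAddGroup.lift (tensorRel (A.obj.obj S) (B.obj.obj S) (M.val.obj S)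
      (N.toRightMod.val.obj S)).toAddSubgroup (γ S) fun z hz => by
        have := hker S z hz 1
        rwa [one_smul] at this
  have hδ (S : Stonean.{u}ᵒᵖ) (n : N.toRightMod.val.obj S) (m : M.val.obj S) :
      δ S (Submodule.Quotient.mk (n ⊗ₜ m)) = β S m n := rfl
  have hδnat {S T : Stonean.{u}ᵒᵖ} (f : S ⟶ T) (x : TensorObj M N S) :
      δ T (tensorRestr M N f x) = restr Q f (δ S x) := by
    obtain ⟨x, rfl⟩ := Submodule.Quotient.mk_surjective _ x
    induction x with
    | zero => simp
    | add x y hx hy => simp only [Submodule.Quotient.mk_add, map_add, hx, hy]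
    | tmul n m => rw [tensorRestr_mk, hδ, hδ, hnat]
  let η : tensorPresheafAb M N ⟶ Q.val.presheaf :=
    { app S := AddCommGrpCat.ofHom (δ S)
      naturality S T f := AddCommGrpCat.hom_ext (AddMonoidHom.ext fun x => hδnat f x) }
  let θ := sheafifyLift topo η Q.isSheaf
  have hθ : toSheafify topo _ ≫ θ = η := toSheafify_sheafifyLift topo η Q.isSheaf
  refine ⟨⟨fun S => (θ.app S).hom, fun f x => ConcreteCategory.congr_hom (θ.naturality f) x⟩,
    fun S m n => ?_⟩
  exact ConcreteCategory.congr_hom (congr_app hθ S)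
    (Submodule.Quotient.mk (n ⊗ₜ m) : TensorObj M N S)

end Tensor

end

section

/-! ### Extension of biadditive maps along sheafifications -/

section Extension

variable {A B D : CondRing.{u}} {M : RightMod A} {N : RightMod B} {Q : RightMod D}
  {N₀ : Stonean.{u}ᵒᵖ ⥤ AddCommGrpCat.{u + 1}} (φ : N₀ ⟶ N.val.presheaf)

/-- A local isomorphism, on the sections over `S`. -/
def secMap (S : Stonean.{u}ᵒᵖ) : N₀.obj S →+ N.val.obj S := (φ.app S).hom

lemma secMap_naturality {S T : Stonean.{u}ᵒᵖ} (f : S ⟶ T) (n : N₀.obj S) :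
    secMap φ T ((N₀.map f).hom n) = restr N f (secMap φ S n) :=
  ConcreteCategory.congr_hom (φ.naturality f) n

lemma exists_cover_secMap [Presheaf.IsLocallySurjective topo φ] {S : Stonean.{u}}
    (n : N.val.obj (op S)) : ∃ C ∈ topo S, ∀ ⦃T : Stonean.{u}⦄ (f : T ⟶ S), C f →
      ∃ n₀ : N₀.obj (op T), secMap φ (op T) n₀ = restr N f.op n :=
  ⟨Presheaf.imageSieve (U := S) φ n, Presheaf.imageSieve_mem topo φ (U := op S) n,
    fun _ _ ⟨n₀, h⟩ => ⟨n₀, h⟩⟩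

lemma exists_cover_eq_of_secMap [Presheaf.IsLocallyInjective topo φ] {S : Stonean.{u}}
    (n n' : N₀.obj (op S)) (h : secMap φ (op S) n = secMap φ (op S) n') :
    ∃ C ∈ topo S, ∀ ⦃T : Stonean.{u}⦄ (f : T ⟶ S), C f →
      (N₀.map f.op).hom n = (N₀.map f.op).hom n' :=
  ⟨_, Presheaf.equalizerSieve_mem topo φ n n' h, fun _ _ hf => hf⟩

variable (β₀ : ∀ S, M.val.obj S →+ N₀.obj S →+ Q.val.obj S)

section

variable (hnat : ∀ {S T : Stonean.{u}ᵒᵖ} (f : S ⟶ T) (m : M.val.obj S) (n : N₀.obj S),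
  β₀ T (restr M f m) ((N₀.map f).hom n) = restr Q f (β₀ S m n))

include hnat in
-- The value at `(m, n)` is glued from the values `β₀ (m, n₀)` over the local lifts `n₀` of `n`.
-- Local surjectivity provides lifts; by local injectivity two lifts agree locally, so their values
-- coincide.
lemma exists_extension_apply [Presheaf.IsLocallyInjective topo φ]
    [Presheaf.IsLocallySurjective topo φ] (S : Stonean.{u}) (m : M.val.obj (op S))
    (n : N.val.obj (op S)) :
    ∃ p : Q.val.obj (op S), ∀ ⦃T : Stonean.{u}⦄ (f : T ⟶ S) (n₀ : N₀.obj (op T)),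
      secMap φ (op T) n₀ = restr N f.op n →
        restr Q f.op p = β₀ (op T) (restr M f.op m) n₀ := by
  obtain ⟨C, hC, hcov⟩ := exists_cover_secMap φ n
  let r ⦃T : Stonean.{u}⦄ (f : T ⟶ S) (p : Q.val.obj (op T)) : Prop :=
    ∃ n₀ : N₀.obj (op T), secMap φ (op T) n₀ = restr N f.op n ∧
      β₀ (op T) (restr M f.op m) n₀ = p
  have h₁ : ∀ ⦃T U : Stonean.{u}⦄ (f : T ⟶ S) (g : U ⟶ T) (p : Q.val.obj (op T)), r f p →
      r (g ≫ f) (restr Q g.op p) := by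
    rintro T U f g _ ⟨n₀, h, rfl⟩
    refine ⟨(N₀.map g.op).hom n₀, ?_, ?_⟩
    · rw [secMap_naturality, h, RightMod.restr_op_comp]
    · rw [RightMod.restr_op_comp, hnat]
  have h₂ : ∀ ⦃T : Stonean.{u}⦄ (f : T ⟶ S) (p q : Q.val.obj (op T)), r f p → r f q → p = q := by
    rintro T f _ _ ⟨n₀, h, rfl⟩ ⟨n₁, h', rfl⟩
    obtain ⟨C', hC', he⟩ := exists_cover_eq_of_secMap φ n₀ n₁ (h.trans h'.symm)
    refine RightMod.ext_of_cover Q hC' fun U g hg => ?_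
    rw [← hnat, ← hnat, he g hg]
  obtain ⟨p, hp⟩ := RightMod.exists_glue Q r h₁ h₂ hC fun T f hf =>
    (hcov f hf).elim fun n₀ h => ⟨_, n₀, h, rfl⟩
  exact ⟨p, fun T f n₀ h => hp f _ ⟨n₀, h, rfl⟩⟩

variable [Presheaf.IsLocallyInjective topo φ] [Presheaf.IsLocallySurjective topo φ]

/-- The extension of a natural biadditive map on `M × N₀` to `M × N`. -/
def extension {S : Stonean.{u}} (m : M.val.obj (op S)) (n : N.val.obj (op S)) :
    Q.val.obj (op S) :=
  (exists_extension_apply φ β₀ hnat S m n).choose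

lemma extension_spec {S T : Stonean.{u}} (m : M.val.obj (op S)) (n : N.val.obj (op S))
    (f : T ⟶ S) (n₀ : N₀.obj (op T)) (h : secMap φ (op T) n₀ = restr N f.op n) :
    restr Q f.op (extension φ β₀ hnat m n) = β₀ (op T) (restr M f.op m) n₀ :=
  (exists_extension_apply φ β₀ hnat S m n).choose_spec f n₀ h

/-- The working criterion: every identity for the extension is checked on a cover over which the
second argument lifts, where it becomes an identity for `β₀`. -/
lemma extension_eq {S : Stonean.{u}} (m : M.val.obj (op S)) (n : N.val.obj (op S))
    (q : Q.val.obj (op S)) {C : Sieve S} (hC : C ∈ topo S)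
    (h : ∀ ⦃T : Stonean.{u}⦄ (f : T ⟶ S), C f → ∃ n₀, secMap φ (op T) n₀ = restr N f.op n ∧
      restr Q f.op q = β₀ (op T) (restr M f.op m) n₀) : extension φ β₀ hnat m n = q := by
  refine RightMod.ext_of_cover Q hC fun T f hf => ?_
  obtain ⟨n₀, h₁, h₂⟩ := h f hf
  rw [h₂, extension_spec φ β₀ hnat m n f n₀ h₁]

lemma extension_add_right {S : Stonean.{u}} (m : M.val.obj (op S)) (n n' : N.val.obj (op S)) :
    extension φ β₀ hnat m (n + n') = extension φ β₀ hnat m n + extension φ β₀ hnat m n' := by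
  obtain ⟨C, hC, hc⟩ := exists_cover_secMap φ n
  obtain ⟨C', hC', hc'⟩ := exists_cover_secMap φ n'
  refine extension_eq φ β₀ hnat m _ _ (topo.intersection_covering hC hC') fun T f hf => ?_
  obtain ⟨n₀, h⟩ := hc f hf.1
  obtain ⟨n₁, h'⟩ := hc' f hf.2
  refine ⟨n₀ + n₁, ?_, ?_⟩
  · rw [map_add, map_add, h, h']
  · rw [map_add, map_add, extension_spec φ β₀ hnat _ _ f n₀ h,
      extension_spec φ β₀ hnat _ _ f n₁ h']

lemma extension_add_left {S : Stonean.{u}} (m m' : M.val.obj (op S)) (n : N.val.obj (op S)) :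
    extension φ β₀ hnat (m + m') n = extension φ β₀ hnat m n + extension φ β₀ hnat m' n := by
  obtain ⟨C, hC, hc⟩ := exists_cover_secMap φ n
  refine extension_eq φ β₀ hnat _ _ _ hC fun T f hf => ?_
  obtain ⟨n₀, h⟩ := hc f hf
  refine ⟨n₀, h, ?_⟩
  rw [map_add, map_add, map_add, extension_spec φ β₀ hnat _ _ f n₀ h,
    extension_spec φ β₀ hnat _ _ f n₀ h, AddMonoidHom.add_apply]

lemma restr_extension {S T : Stonean.{u}} (f : T ⟶ S) (m : M.val.obj (op S))
    (n : N.val.obj (op S)) : extension φ β₀ hnat (restr M f.op m) (restr N f.op n) =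
      restr Q f.op (extension φ β₀ hnat m n) := by
  obtain ⟨C, hC, hc⟩ := exists_cover_secMap φ n
  refine extension_eq φ β₀ hnat _ _ _ (topo.pullback_stable f hC) fun U g hg => ?_
  obtain ⟨n₀, h⟩ := hc _ hg
  refine ⟨n₀, ?_, ?_⟩
  · rw [h, RightMod.restr_op_comp]
  · rw [← RightMod.restr_op_comp, extension_spec φ β₀ hnat _ _ _ n₀ h, RightMod.restr_op_comp]

lemma extension_secMap {S : Stonean.{u}} (m : M.val.obj (op S)) (n : N₀.obj (op S)) :
    extension φ β₀ hnat m (secMap φ (op S) n) = β₀ (op S) m n :=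
  extension_eq φ β₀ hnat _ _ _ (topo.top_mem _) fun _ f _ =>
    ⟨(N₀.map f.op).hom n, secMap_naturality φ f.op n, (hnat f.op m n).symm⟩

end

/-- A natural biadditive map on `M × N₀` extends to `M × N` if `N` is the sheafification
of `N₀`. -/
lemma exists_extension [Presheaf.IsLocallyInjective topo φ] [Presheaf.IsLocallySurjective topo φ]
    (hnat : ∀ {S T : Stonean.{u}ᵒᵖ} (f : S ⟶ T) (m : M.val.obj S) (n : N₀.obj S),
      β₀ T (restr M f m) ((N₀.map f).hom n) = restr Q f (β₀ S m n)) :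
    ∃ β : ∀ S, M.val.obj S →+ N.val.obj S →+ Q.val.obj S,
      (∀ {S T : Stonean.{u}ᵒᵖ} (f : S ⟶ T) (m : M.val.obj S) (n : N.val.obj S),
        β T (restr M f m) (restr N f n) = restr Q f (β S m n)) ∧
      ∀ S m n, β S m (secMap φ S n) = β₀ S m n :=
  ⟨fun S => AddMonoidHom.mk' (fun m => AddMonoidHom.mk'
      (fun n => extension φ β₀ hnat (S := S.unop) m n) (extension_add_right φ β₀ hnat m))
      fun m m' => AddMonoidHom.ext fun n => extension_add_left φ β₀ hnat m m' n,
    fun f m n => restr_extension φ β₀ hnat f.unop m n,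
    fun _ m n => extension_secMap φ β₀ hnat m n⟩

end Extension

/-! ### The action of the group ring -/

section Act

variable {R : CondRing.{u}} {G : CondGrp.{u}}

/-- The ring homomorphism from the group ring of the sections to the sections of the group ring. -/
def toGR (R : CondRing.{u}) (G : CondGrp.{u}) (S : Stonean.{u}ᵒᵖ) :
    MonoidAlgebra (R.obj.obj S) (G.obj.obj S) →+* (groupRing R G).obj.obj S :=
  ((toGroupRing R G).app S).hom

/-- The restriction maps of the presheaf of group rings. -/
def grRestr (R : CondRing.{u}) (G : CondGrp.{u}) {S T : Stonean.{u}ᵒᵖ} (f : S ⟶ T) :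
    MonoidAlgebra (R.obj.obj S) (G.obj.obj S) →+* MonoidAlgebra (R.obj.obj T) (G.obj.obj T) :=
  monoidAlgebraMap (R.obj.map f).hom (G.obj.map f).hom

lemma toGR_grRestr {S T : Stonean.{u}ᵒᵖ} (f : S ⟶ T)
    (a : MonoidAlgebra (R.obj.obj S) (G.obj.obj S)) :
    toGR R G T (grRestr R G f a) = ((groupRing R G).obj.map f).hom (toGR R G S a) :=
  RingHom.congr_fun (congrArg RingCat.Hom.hom ((toGroupRing R G).naturality f)) a

lemma exists_cover_toGR {S : Stonean.{u}} (a : (groupRing R G).obj.obj (op S)) :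
    ∃ C ∈ topo S, ∀ ⦃T : Stonean.{u}⦄ (f : T ⟶ S), C f →
      ∃ a₀, toGR R G (op T) a₀ = ((groupRing R G).obj.map f.op).hom a :=
  ⟨_, Presheaf.imageSieve_mem topo (toGroupRing R G) a, fun _ _ hf => hf⟩

/-- The ring homomorphism between sections of group rings induced by a homomorphism of groups. -/
def grMap (R : CondRing.{u}) {G G' : CondGrp.{u}} (i : G ⟶ G') (S : Stonean.{u}ᵒᵖ) :
    MonoidAlgebra (R.obj.obj S) (G.obj.obj S) →+* MonoidAlgebra (R.obj.obj S) (G'.obj.obj S) :=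
  monoidAlgebraMap (RingHom.id _) (i.hom.app S).hom

lemma grMap_single {G G' : CondGrp.{u}} (i : G ⟶ G') {S : Stonean.{u}ᵒᵖ} (x : G.obj.obj S)
    (r : R.obj.obj S) : grMap R i S (MonoidAlgebra.single x r) =
      MonoidAlgebra.single ((i.hom.app S).hom x) r :=
  monoidAlgebraMap_single _ _ _ _

/-- Naturality of the unit of sheafification; it reduces computations with `R[G] → R[G']` to
ordinary group rings. -/
lemma groupRingMap_toGR {G G' : CondGrp.{u}} (i : G ⟶ G') {S : Stonean.{u}ᵒᵖ}
    (a : MonoidAlgebra (R.obj.obj S) (G.obj.obj S)) :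
    ((groupRingMap R i).hom.app S).hom (toGR R G S a) = toGR R G' S (grMap R i S a) :=
  (RingHom.congr_fun (congrArg RingCat.Hom.hom (congr_app (toSheafify_naturality topo
    (groupRingPresheafMap R i)) S)) a).symm

/-- The right action of an element of the group ring of the sections. -/
def act (X : RightMod (groupRing R G)) {S : Stonean.{u}ᵒᵖ}
    (a : MonoidAlgebra (R.obj.obj S) (G.obj.obj S)) (x : X.val.obj S) : X.val.obj S :=
  MulOpposite.op (toGR R G S a) • x

variable (X : RightMod (groupRing R G))

lemma act_mul {S : Stonean.{u}ᵒᵖ} (a b : MonoidAlgebra (R.obj.obj S) (G.obj.obj S))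
    (x : X.val.obj S) : act X (a * b) x = act X b (act X a x) := by
  rw [act, map_mul, MulOpposite.op_mul, mul_smul]; rfl

lemma act_one {S : Stonean.{u}ᵒᵖ} (x : X.val.obj S) : act X 1 x = x := by
  rw [act, map_one, MulOpposite.op_one, one_smul]

lemma act_add {S : Stonean.{u}ᵒᵖ} (a b : MonoidAlgebra (R.obj.obj S) (G.obj.obj S))
    (x : X.val.obj S) : act X (a + b) x = act X a x + act X b x := by
  rw [act, map_add, MulOpposite.op_add, add_smul]; rfl

lemma act_zero {S : Stonean.{u}ᵒᵖ} (x : X.val.obj S) : act X 0 x = 0 := by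
  rw [act, map_zero, MulOpposite.op_zero]
  exact zero_smul _ _

lemma act_add_right {S : Stonean.{u}ᵒᵖ} (a : MonoidAlgebra (R.obj.obj S) (G.obj.obj S))
    (x y : X.val.obj S) : act X a (x + y) = act X a x + act X a y := smul_add _ _ _

lemma act_zero_right {S : Stonean.{u}ᵒᵖ} (a : MonoidAlgebra (R.obj.obj S) (G.obj.obj S)) :
    act X a 0 = 0 := smul_zero _

lemma restr_act {S T : Stonean.{u}ᵒᵖ} (f : S ⟶ T)
    (a : MonoidAlgebra (R.obj.obj S) (G.obj.obj S)) (x : X.val.obj S) :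
    restr X f (act X a x) = act X (grRestr R G f a) (restr X f x) := by
  rw [act, RightMod.restr_smul, act, toGR_grRestr]

lemma grRestr_single {S T : Stonean.{u}ᵒᵖ} (f : S ⟶ T) (x : G.obj.obj S) (r : R.obj.obj S) :
    grRestr R G f (MonoidAlgebra.single x r) =
      MonoidAlgebra.single ((G.obj.map f).hom x) ((R.obj.map f).hom r) :=
  monoidAlgebraMap_single _ _ _ _

lemma act_res {G' : CondGrp.{u}} (i : G ⟶ G') (Y : RightMod (groupRing R G'))
    {S : Stonean.{u}ᵒᵖ} (a : MonoidAlgebra (R.obj.obj S) (G.obj.obj S)) (y : Y.val.obj S) :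
    act ((res (groupRingMap R i)).obj Y) a y = act Y (grMap R i S a) y := by
  rw [act, ← groupRingMap_toGR]
  rfl

variable {X} {Y : RightMod (groupRing R G)}

/-- It suffices to check linearity over the group ring on the elements `r • x`. -/
lemma NatAddHom.linear_of_single (F : NatAddHom X Y)
    (h : ∀ S (x : G.obj.obj S) (r : R.obj.obj S) (m : X.val.obj S),
      F.app S (act X (MonoidAlgebra.single x r) m) = act Y (MonoidAlgebra.single x r) (F.app S m))
    (S : Stonean.{u}ᵒᵖ) (a : (groupRing R G).obj.obj S) (m : X.val.obj S) :
    F.app S (MulOpposite.op a • m) = MulOpposite.op a • F.app S m := by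
  have h' (S : Stonean.{u}ᵒᵖ) (a : MonoidAlgebra (R.obj.obj S) (G.obj.obj S))
      (m : X.val.obj S) : F.app S (act X a m) = act Y a (F.app S m) := by
    induction a using MonoidAlgebra.induction_linear with
    | zero => rw [act_zero, act_zero, map_zero]
    | add a b ha hb => rw [act_add, act_add, map_add, ha, hb]
    | single x r => exact h S x r m
  -- A section of `R[G]` is only locally an element of an ordinary group ring, so linearity is
  -- verified on a cover where `a` lifts.
  obtain ⟨C, hC, hc⟩ := exists_cover_toGR (S := S.unop) a
  refine RightMod.ext_of_cover Y (S := S.unop) hC fun T f hf => ?_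
  obtain ⟨a₀, ha₀⟩ := hc f hf
  refine (F.naturality f.op _).symm.trans ?_
  rw [RightMod.restr_smul, RightMod.restr_smul, ← F.naturality, ← ha₀]
  exact h' _ a₀ _

/-- It suffices to check balancedness over the group ring on the elements `r • x`. -/
lemma balanced_of_single {B D : CondRing.{u}} {N : Bimod (groupRing R G) B} {Q : RightMod D}
    (β : ∀ S, X.val.obj S →+ N.toRightMod.val.obj S →+ Q.val.obj S)
    (hnat : ∀ {S T : Stonean.{u}ᵒᵖ} (f : S ⟶ T) (m : X.val.obj S) (n : N.toRightMod.val.obj S),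
      β T (restr X f m) (restr N.toRightMod f n) = restr Q f (β S m n))
    (h : ∀ S (x : G.obj.obj S) (r : R.obj.obj S) (m : X.val.obj S) (n : N.toRightMod.val.obj S),
      β S (act X (MonoidAlgebra.single x r) m) n =
        β S m (toGR R G S (MonoidAlgebra.single x r) • n))
    (S : Stonean.{u}ᵒᵖ) (m : X.val.obj S) (a : (groupRing R G).obj.obj S)
    (n : N.toRightMod.val.obj S) : β S (MulOpposite.op a • m) n = β S m (a • n) := by
  have h' (S : Stonean.{u}ᵒᵖ) (a : MonoidAlgebra (R.obj.obj S) (G.obj.obj S))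
      (m : X.val.obj S) (n : N.toRightMod.val.obj S) :
      β S (act X a m) n = β S m (toGR R G S a • n) := by
    induction a using MonoidAlgebra.induction_linear with
    | zero => rw [act_zero, map_zero, map_zero, zero_smul, map_zero, AddMonoidHom.zero_apply]
    | add a b ha hb =>
      rw [act_add, map_add, map_add, add_smul, map_add, AddMonoidHom.add_apply, ha, hb]
    | single x r => exact h S x r m n
  obtain ⟨C, hC, hc⟩ := exists_cover_toGR (S := S.unop) a
  refine RightMod.ext_of_cover Q (S := S.unop) hC fun T f hf => ?_
  obtain ⟨a₀, ha₀⟩ := hc f hf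
  refine (hnat f.op _ _).symm.trans (Eq.trans ?_ (hnat f.op _ _))
  rw [RightMod.restr_smul, N.restr_smul, ← ha₀]
  exact h' _ a₀ _ _

end Act

end

section

variable {R : CondRing.{u}}

/-! ### Induced modules -/

section Ind

variable (R) in
/-- The map from the presheaf of group rings to `R[G]`, as a map to the regular module. -/
def toRegular (G : CondGrp.{u}) :
    groupRingPresheaf R G ⋙ forget₂ RingCat.{u + 1} AddCommGrpCat.{u + 1} ⟶
      (regular (groupRing R G)).val.presheaf :=
  Functor.whiskerRight (toGroupRing R G) (forget₂ RingCat.{u + 1} AddCommGrpCat.{u + 1})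

instance (G : CondGrp.{u}) : Presheaf.IsLocallyInjective topo (toRegular R G) where
  equalizerSieve_mem {S} x y h := by
    refine topo.superset_covering ?_ (Presheaf.equalizerSieve_mem topo (toGroupRing R G) (X := S)
      (show (groupRingPresheaf R G).obj S from x) (show (groupRingPresheaf R G).obj S from y) h)
    intro T f hf
    exact hf

instance (G : CondGrp.{u}) : Presheaf.IsLocallySurjective topo (toRegular R G) where
  imageSieve_mem {S} x := by
    refine topo.superset_covering ?_ (Presheaf.imageSieve_mem topo (toGroupRing R G) (U := op S)
      (show (groupRing R G).obj.obj (op S) from x))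
    rintro T f ⟨n, hn⟩
    exact ⟨n, hn⟩

variable {Γ G : CondGrp.{u}} (i : Γ ⟶ G) (M : RightMod (groupRing R Γ))

/-- The section `m ⊗ b` of the induced module. -/
def indMk {S : Stonean.{u}ᵒᵖ} (m : M.val.obj S) (b : (groupRing R G).obj.obj S) :
    (ind R i M).val.obj S :=
  tmk M (Bimod.ofHom (groupRingMap R i)) m b

lemma indMk_add_left {S : Stonean.{u}ᵒᵖ} (m m' : M.val.obj S) (b : (groupRing R G).obj.obj S) :
    indMk i M (m + m') b = indMk i M m b + indMk i M m' b := tmk_add_left _ _ _ _ _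

lemma indMk_act {S : Stonean.{u}ᵒᵖ} (m : M.val.obj S)
    (a : MonoidAlgebra (R.obj.obj S) (Γ.obj.obj S)) (b : (groupRing R G).obj.obj S) :
    indMk i M (act M a m) b = indMk i M m (toGR R G S (grMap R i S a) * b) := by
  refine (tmk_smul_left _ _ _ _ _).trans ?_
  exact congrArg (fun z => indMk i M m (z * b)) (groupRingMap_toGR i a)

lemma smul_indMk {S : Stonean.{u}ᵒᵖ} (m : M.val.obj S) (b c : (groupRing R G).obj.obj S) :
    MulOpposite.op c • indMk i M m b = indMk i M m (b * c) := smul_tmk _ _ _ _ _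

lemma act_indMk {S : Stonean.{u}ᵒᵖ} (m : M.val.obj S) (b : (groupRing R G).obj.obj S)
    (a : MonoidAlgebra (R.obj.obj S) (G.obj.obj S)) :
    act (ind R i M) a (indMk i M m b) = indMk i M m (b * toGR R G S a) := smul_indMk i M m b _

lemma restr_indMk {S T : Stonean.{u}ᵒᵖ} (f : S ⟶ T) (m : M.val.obj S)
    (b : (groupRing R G).obj.obj S) :
    restr (ind R i M) f (indMk i M m b) =
      indMk i M (restr M f m) (((groupRing R G).obj.map f).hom b) := restr_tmk _ _ _ _ _

variable {i M}

/-- Extension of scalars is left adjoint to restriction. -/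
lemma exists_ind_hom {P : RightMod (groupRing R G)}
    (F : NatAddHom M P) (hF : ∀ S (a : Γ.obj.obj S) (r : R.obj.obj S) (m : M.val.obj S),
      F.app S (act M (MonoidAlgebra.single a r) m) =
        act P (MonoidAlgebra.single ((i.hom.app S).hom a) r) (F.app S m)) :
    ∃ E : ind R i M ⟶ P, ∀ S (m : M.val.obj S),
      E.val.app S (indMk i M m 1) = F.app S m := by
  let β (S : Stonean.{u}ᵒᵖ) : M.val.obj S →+ (groupRing R G).obj.obj S →+ P.val.obj S :=
    AddMonoidHom.mk' (fun m => AddMonoidHom.mk' (fun b => MulOpposite.op b • F.app S m)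
      fun b b' => by rw [MulOpposite.op_add, add_smul])
      fun m m' => AddMonoidHom.ext fun b => by
        change MulOpposite.op b • F.app S (m + m') =
          MulOpposite.op b • F.app S m + MulOpposite.op b • F.app S m'
        rw [map_add, smul_add]
  have hβ (S : Stonean.{u}ᵒᵖ) (m : M.val.obj S) (b : (groupRing R G).obj.obj S) :
    β S m b = MulOpposite.op b • F.app S m := rfl
  have hnat {S T : Stonean.{u}ᵒᵖ} (f : S ⟶ T) (m : M.val.obj S)
      (b : (groupRing R G).obj.obj S) :
      β T (restr M f m) (((groupRing R G).obj.map f).hom b) = restr P f (β S m b) := by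
    rw [hβ, hβ, RightMod.restr_smul, F.naturality]
  obtain ⟨E, hE⟩ := exists_natAddHom_tensor (N := Bimod.ofHom (groupRingMap R i)) β
    (fun f m n => hnat f m n) (balanced_of_single (N := Bimod.ofHom (groupRingMap R i)) β
    (fun f m n => hnat f m n) fun S x r m n => by
      let n' : (groupRing R G).obj.obj S := n
      -- With `β(m, b) = F(m) b`, balancedness on the elements `r • x` is the hypothesis `hF`
      -- together with associativity.
      refine (congrArg (fun z => MulOpposite.op n' • z) (hF S x r m)).trans ?_
      rw [act, ← mul_smul, ← MulOpposite.op_mul, ← grMap_single, ← groupRingMap_toGR]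
      rfl)
  have hE' (S : Stonean.{u}ᵒᵖ) (m : M.val.obj S) (b : (groupRing R G).obj.obj S) :
      E.app S (indMk i M m b) = MulOpposite.op b • F.app S m := hE S m b
  have hlin (S : Stonean.{u}ᵒᵖ) (c : (groupRing R G).obj.obj S) (t : (ind R i M).val.obj S) :
      E.app S (MulOpposite.op c • t) = MulOpposite.op c • E.app S t := by
    refine E.map_smul_of_tmk (S := S.unop) c c (fun T f m b => ?_) t
    refine (hE' _ _ _).trans (Eq.trans ?_ (congrArg _ (hE' _ m b).symm))
    exact mul_smul (MulOpposite.op (((groupRing R G).obj.map f.op).hom c))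
      (MulOpposite.op (show (groupRing R G).obj.obj (op T) from b)) (F.app (op T) m)
  refine ⟨E.toHom hlin, fun S m => ?_⟩
  refine (hE' S m 1).trans ?_
  rw [MulOpposite.op_one, one_smul]

/-- Morphisms out of an induced module are determined by their values on the sections `m ⊗ 1`. -/
lemma ind_hom_ext {P : RightMod (groupRing R G)} {E E' : ind R i M ⟶ P}
    (h : ∀ S (m : M.val.obj S),
      E.val.app S (indMk i M m 1) = E'.val.app S (indMk i M m 1)) : E = E' := by
  have key := NatAddHom.ext_tmk (F := NatAddHom.ofHom E) (F' := NatAddHom.ofHom E')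
    fun S m b => by
      -- Every pure tensor is `(m ⊗ 1) b`, so linearity reduces to the sections `m ⊗ 1`.
      have e : tmk M (Bimod.ofHom (groupRingMap R i)) m b =
          MulOpposite.op (show (groupRing R G).obj.obj S from b) • indMk i M m 1 := by
        rw [smul_indMk, one_mul]
        rfl
      refine (congrArg (E.val.app S) e).trans (Eq.trans ?_ (congrArg (E'.val.app S) e).symm)
      rw [RightMod.hom_map_smul, RightMod.hom_map_smul, h]
  refine SheafOfModules.hom_ext (PresheafOfModules.hom_ext fun S => ?_)
  exact ModuleCat.hom_ext (LinearMap.ext fun x => key S x)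

end Ind

end

section

variable {R : CondRing.{u}}

/-! ### Tensor products with the bimodule `R[Hg]` -/

section Coset

variable {G : CondGrp.{u}} (H : CondSubgroup G) (g : CondGrp.underlying G)

variable (R) in
/-- The map from the presheaf `S ↦ R(S)[H(S)g]` to `R[Hg]`. -/
def toCosetBimod : cosetPresheaf R H g ⟶ (cosetBimod R H g).toRightMod.val.presheaf :=
  toSheafify topo (cosetPresheaf R H g)

instance : Presheaf.IsLocallyInjective topo (toCosetBimod R H g) :=
  inferInstanceAs (Presheaf.IsLocallyInjective topo (toSheafify topo (cosetPresheaf R H g)))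

instance : Presheaf.IsLocallySurjective topo (toCosetBimod R H g) :=
  inferInstanceAs (Presheaf.IsLocallySurjective topo (toSheafify topo (cosetPresheaf R H g)))

/-- The presheaf sections of `R[Hg]`. -/
abbrev CosetSec (R : CondRing.{u}) {G : CondGrp.{u}} (H : CondSubgroup G)
    (g : CondGrp.underlying G) (S : Stonean.{u}ᵒᵖ) :=
  cosetSpan (R.obj.obj S) (H.obj S) (CondGrp.const G g S)

/-- The section of `R[Hg]` defined by an element of `R(S)[H(S)g]`. -/
def cosetMk {S : Stonean.{u}ᵒᵖ} (n : CosetSec R H g S) :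
    (cosetBimod R H g).toRightMod.val.obj S :=
  secMap (toCosetBimod R H g) S n

lemma toGR_smul_cosetMk {S : Stonean.{u}ᵒᵖ}
    (a : MonoidAlgebra (R.obj.obj S) (H.toCondGrp.obj.obj S)) (n : CosetSec R H g S) :
    toGR R H.toCondGrp S a • cosetMk H g n =
      cosetMk H g ((show MonoidAlgebra (R.obj.obj S) (H.obj S) from a) • n) :=
  (((PresheafOfModules.toSheafify (toGroupRing R H.toCondGrp)
    (toSheafify topo (cosetLeft R H g).presheaf)).app S).hom.map_smul a n).symm

lemma act_cosetMk {S : Stonean.{u}ᵒᵖ}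
    (c : MonoidAlgebra (R.obj.obj S) ((H.conj g).toCondGrp.obj.obj S)) (n : CosetSec R H g S) :
    act (cosetBimod R H g).toRightMod c (cosetMk H g n) =
      cosetMk H g (MulOpposite.op (show MonoidAlgebra (R.obj.obj S)
        (conjSubgroup (H.obj S) (CondGrp.const G g S)) from c) • n) :=
  (((PresheafOfModules.toSheafify (toGroupRingOp R (H.conj g).toCondGrp)
    (toSheafify topo (cosetRight R H g).presheaf)).app S).hom.map_smul (MulOpposite.op c) n).symm

variable (M : RightMod (groupRing R H.toCondGrp))

/-- The section `m ⊗ n` of `M ⊗_{R[H]} R[Hg]`, where `n` is an element of `R(S)[H(S)g]`. -/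
def cosetTmk {S : Stonean.{u}ᵒᵖ} (m : M.val.obj S) (n : CosetSec R H g S) :
    (tensor M (cosetBimod R H g)).val.obj S :=
  tmk M (cosetBimod R H g) m (cosetMk H g n)

lemma cosetTmk_add_left {S : Stonean.{u}ᵒᵖ} (m m' : M.val.obj S) (n : CosetSec R H g S) :
    cosetTmk H g M (m + m') n = cosetTmk H g M m n + cosetTmk H g M m' n :=
  tmk_add_left _ _ _ _ _

lemma cosetTmk_add_right {S : Stonean.{u}ᵒᵖ} (m : M.val.obj S) (n n' : CosetSec R H g S) :
    cosetTmk H g M m (n + n') = cosetTmk H g M m n + cosetTmk H g M m n' :=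
  (congrArg (tmk M (cosetBimod R H g) m) (map_add (secMap (toCosetBimod R H g) S) n n')).trans
    (tmk_add_right _ _ _ _ _)

lemma cosetTmk_act {S : Stonean.{u}ᵒᵖ} (m : M.val.obj S)
    (a : MonoidAlgebra (R.obj.obj S) (H.toCondGrp.obj.obj S)) (n : CosetSec R H g S) :
    cosetTmk H g M (act M a m) n =
      cosetTmk H g M m ((show MonoidAlgebra (R.obj.obj S) (H.obj S) from a) • n) :=
  (tmk_smul_left _ _ _ _ _).trans
    (congrArg (tmk M (cosetBimod R H g) m) (toGR_smul_cosetMk H g a n))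

lemma act_cosetTmk {S : Stonean.{u}ᵒᵖ} (m : M.val.obj S)
    (c : MonoidAlgebra (R.obj.obj S) ((H.conj g).toCondGrp.obj.obj S)) (n : CosetSec R H g S) :
    act (tensor M (cosetBimod R H g)) c (cosetTmk H g M m n) =
      cosetTmk H g M m (MulOpposite.op (show MonoidAlgebra (R.obj.obj S)
        (conjSubgroup (H.obj S) (CondGrp.const G g S)) from c) • n) :=
  (smul_tmk _ _ _ _ _).trans
    (congrArg (tmk M (cosetBimod R H g) m) (act_cosetMk H g c n))

lemma restr_cosetTmk {S T : Stonean.{u}ᵒᵖ} (f : S ⟶ T) (m : M.val.obj S)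
    (n : CosetSec R H g S) :
    restr (tensor M (cosetBimod R H g)) f (cosetTmk H g M m n) =
      cosetTmk H g M (restr M f m) (cosetRestr R H g f n) :=
  (restr_tmk _ _ _ _ _).trans
    (congrArg (tmk M (cosetBimod R H g) (restr M f m))
      (secMap_naturality (toCosetBimod R H g) f n).symm)

variable {H g M}

/-- Additive maps out of `M ⊗_{R[H]} R[Hg]` are determined by their values on the sections
`m ⊗ n`, where `n` is an element of `R(S)[H(S)g]`. -/
lemma natAddHom_ext_cosetTmk {D : CondRing.{u}} {Q : RightMod D}
    {F F' : NatAddHom (tensor M (cosetBimod R H g)) Q}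
    (h : ∀ S m n, F.app S (cosetTmk H g M m n) = F'.app S (cosetTmk H g M m n))
    (S : Stonean.{u}ᵒᵖ) (t : (tensor M (cosetBimod R H g)).val.obj S) :
    F.app S t = F'.app S t := by
  refine NatAddHom.ext_tmk (fun S m n => ?_) S t
  obtain ⟨C, hC, hc⟩ := exists_cover_secMap (toCosetBimod R H g) (S := S.unop) n
  refine RightMod.ext_of_cover Q (S := S.unop) hC fun T f hf => ?_
  obtain ⟨n₀, hn₀⟩ := hc f hf
  refine (F.naturality f.op _).symm.trans (Eq.trans ?_ (F'.naturality f.op _))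
  rw [restr_tmk]
  refine (congrArg (fun z => F.app (op T) (tmk M (cosetBimod R H g) _ z)) hn₀).symm.trans
    (Eq.trans ?_ (congrArg (fun z => F'.app (op T) (tmk M (cosetBimod R H g) _ z)) hn₀))
  exact h _ _ _

/-- Maps out of `M ⊗_{R[H]} R[Hg]`. -/
lemma exists_natAddHom_coset {D : CondRing.{u}} {Q : RightMod D}
    (β : ∀ S, M.val.obj S →+ CosetSec R H g S →+ Q.val.obj S)
    (hnat : ∀ {S T : Stonean.{u}ᵒᵖ} (f : S ⟶ T) (m : M.val.obj S) (n : CosetSec R H g S),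
      β T (restr M f m) (cosetRestr R H g f n) = restr Q f (β S m n))
    (hbal : ∀ (S : Stonean.{u}ᵒᵖ) (m : M.val.obj S)
      (a : MonoidAlgebra (R.obj.obj S) (H.obj S)) (n : CosetSec R H g S),
      β S (act M (show MonoidAlgebra (R.obj.obj S) (H.toCondGrp.obj.obj S) from a) m) n =
        β S m (a • n)) :
    ∃ F : NatAddHom (tensor M (cosetBimod R H g)) Q,
      ∀ S m n, F.app S (cosetTmk H g M m n) = β S m n := by
  -- The tensor product involves the sheafified bimodule, so `β` must first be extended from the
  -- presheaf; balancedness of the extension is then verified where `n` lifts.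
  obtain ⟨β', hnat', hβ'⟩ := exists_extension (toCosetBimod R H g) β hnat
  obtain ⟨F, hF⟩ := exists_natAddHom_tensor (N := cosetBimod R H g) β' hnat'
    (balanced_of_single β' hnat' fun S x r m n => by
      obtain ⟨C, hC, hc⟩ := exists_cover_secMap (toCosetBimod R H g) (S := S.unop) n
      refine RightMod.ext_of_cover Q (S := S.unop) hC fun T f hf => ?_
      obtain ⟨n₀, hn₀⟩ := hc f hf
      refine (hnat' f.op _ _).symm.trans (Eq.trans ?_ (hnat' f.op _ _))
      have h₁ := (cosetBimod R H g).restr_smul f.op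
        (toGR R H.toCondGrp S (MonoidAlgebra.single x r)) n
      rw [← toGR_grRestr] at h₁
      refine Eq.trans ?_ (congrArg (β' (op T) _) h₁).symm
      rw [restr_act]
      refine (congrArg (β' (op T) _) hn₀).symm.trans ?_
      refine (hβ' _ _ _).trans ((hbal _ _ _ _).trans ((hβ' _ _ _).symm.trans ?_))
      refine congrArg (β' (op T) _) ((toGR_smul_cosetMk H g _ n₀).symm.trans ?_)
      exact congrArg (fun z => toGR R H.toCondGrp (op T) (grRestr R H.toCondGrp f.op
        (MonoidAlgebra.single x r)) • z) hn₀)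
  exact ⟨F, fun S m n => (hF S m _).trans (hβ' S m n)⟩

end Coset

end

section

variable {R : CondRing.{u}} {G : CondGrp.{u}} {H : CondSubgroup G} {g : CondGrp.underlying G}
  {M : RightMod (groupRing R H.toCondGrp)}

/-! ### The maps from the Mackey terms to the restriction of the induced module -/

/-- Compatibility with the action of the group ring may be checked on the sections `m ⊗ n`, where
`n` is an element of `R(S)[H(S)g]`. -/
lemma NatAddHom.map_act_of_cosetTmk {Δ : CondGrp.{u}} {Q : RightMod (groupRing R Δ)}
    (F : NatAddHom (tensor M (cosetBimod R H g)) Q) {S : Stonean.{u}ᵒᵖ}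
    (c : MonoidAlgebra (R.obj.obj S) ((H.conj g).toCondGrp.obj.obj S))
    (d : MonoidAlgebra (R.obj.obj S) (Δ.obj.obj S))
    (h : ∀ ⦃T : Stonean.{u}ᵒᵖ⦄ (f : S ⟶ T) (m : M.val.obj T) (n : CosetSec R H g T),
      F.app T (act _ (grRestr R _ f c) (cosetTmk H g M m n)) =
        act Q (grRestr R Δ f d) (F.app T (cosetTmk H g M m n)))
    (t : (tensor M (cosetBimod R H g)).val.obj S) :
    F.app S (act _ c t) = act Q d (F.app S t) := by
  refine F.map_smul_of_tmk (S := S.unop) _ _ (fun T f m n => ?_) t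
  obtain ⟨C, hC, hc⟩ := exists_cover_secMap (toCosetBimod R H g) n
  refine RightMod.ext_of_cover Q hC fun U f' hf' => ?_
  obtain ⟨n₀, hn₀⟩ := hc f' hf'
  -- The section of `R[Hg]` lifts to the presheaf only after a further restriction `f'`, which is
  -- why `h` is required for all restrictions of `c` and `d`.
  have h₁ := h (f.op ≫ f'.op) (restr M f'.op m) n₀
  refine (F.naturality f'.op _).symm.trans ?_
  rw [← smul_tmk, RightMod.restr_smul, RightMod.restr_smul, ← F.naturality, restr_tmk]
  have e₁ : ((groupRing R (H.conj g).toCondGrp).obj.map f'.op).hom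
      (((groupRing R (H.conj g).toCondGrp).obj.map f.op).hom (toGR R _ S c)) =
      toGR R _ (op U) (grRestr R _ (f.op ≫ f'.op) c) := by
    rw [toGR_grRestr, Functor.map_comp]; rfl
  have e₂ : ((groupRing R Δ).obj.map f'.op).hom
      (((groupRing R Δ).obj.map f.op).hom (toGR R _ S d)) =
      toGR R _ (op U) (grRestr R _ (f.op ≫ f'.op) d) := by
    rw [toGR_grRestr, Functor.map_comp]; rfl
  have e₃ : tmk M (cosetBimod R H g) (restr M f'.op m)
      (restr (cosetBimod R H g).toRightMod f'.op n) = cosetTmk H g M (restr M f'.op m) n₀ :=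
    congrArg _ hn₀.symm
  rw [e₃]
  refine (congrArg (fun z => F.app (op U) (MulOpposite.op z • _)) e₁).trans (h₁.trans ?_)
  exact congrArg (fun z => MulOpposite.op z • F.app (op U) (cosetTmk H g M (restr M f'.op m) n₀))
    e₂.symm

variable (R H g M)

/-- This map is induced by the inclusions `R(S)[H(S)g] ⊆ R(S)[G(S)]`. It is balanced because
`R(S)[H(S)]` acts on the coset span by multiplication in `R(S)[G(S)]`. -/
lemma exists_coset_to_ind :
    ∃ j : NatAddHom (tensor M (cosetBimod R H g)) (ind R H.incl M),
      ∀ S m (n : CosetSec R H g S),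
        j.app S (cosetTmk H g M m n) = indMk H.incl M m (toGR R G S n.1) := by
  let β (S : Stonean.{u}ᵒᵖ) :
      M.val.obj S →+ CosetSec R H g S →+ (ind R H.incl M).val.obj S :=
    AddMonoidHom.mk' (fun m => AddMonoidHom.mk'
      (fun n => indMk H.incl M m (toGR R G S n.1)) fun n n' => by
        rw [AddSubgroup.coe_add, map_add]
        exact tmk_add_right _ _ _ _ _)
      fun m m' => AddMonoidHom.ext fun n => indMk_add_left _ _ _ _ _
  have hβ S m (n : CosetSec R H g S) : β S m n = indMk H.incl M m (toGR R G S n.1) := rfl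
  refine exists_natAddHom_coset β (fun f m n => ?_) (fun S m a n => ?_)
  · rw [hβ, hβ, restr_indMk, ← toGR_grRestr]
    rfl
  · rw [hβ, hβ, indMk_act, ← map_mul]
    rfl

/-- By `exists_ind_hom` it suffices that the map of `exists_coset_to_ind` respects the action of `K
∩ g⁻¹Hg`. On both sides this group acts by right multiplication in the group ring of `G`. -/
lemma exists_mackeyTerm_hom (K : CondSubgroup G) :
    ∃ ι : mackeyTerm R H K M g ⟶ (res (groupRingMap R K.incl)).obj (ind R H.incl M),
      ∀ S m (n : CosetSec R H g S),
        ι.val.app S (indMk (CondSubgroup.inclOfLE (CondSubgroup.inf_le_left K (H.conj g)))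
          ((res (groupRingMap R (CondSubgroup.inclOfLE
            (CondSubgroup.inf_le_right K (H.conj g))))).obj (tensor M (cosetBimod R H g)))
          (cosetTmk H g M m n) 1) = indMk H.incl M m (toGR R G S n.1) := by
  obtain ⟨j, hj⟩ := exists_coset_to_ind R H g M
  -- Restriction of scalars does not change the sections, so the same additive maps are reused
  -- between the restricted modules.
  let F : NatAddHom ((res (groupRingMap R (CondSubgroup.inclOfLE
      (CondSubgroup.inf_le_right K (H.conj g))))).obj (tensor M (cosetBimod R H g)))
      ((res (groupRingMap R K.incl)).obj (ind R H.incl M)) := ⟨j.app, j.naturality⟩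
  obtain ⟨ι, hι⟩ := exists_ind_hom
    (i := CondSubgroup.inclOfLE (CondSubgroup.inf_le_left K (H.conj g))) F fun S a r t => by
      let t' : (tensor M (cosetBimod R H g)).val.obj S := t
      refine (congrArg (j.app S) (act_res _ (tensor M (cosetBimod R H g)) _ t')).trans
        (Eq.trans ?_ (act_res K.incl (ind R H.incl M) _ (j.app S t')).symm)
      rw [grMap_single, grMap_single]
      refine j.map_act_of_cosetTmk _ _ (fun T f m n => ?_) t'
      rw [act_cosetTmk, hj, hj, act_indMk, grRestr_single, grRestr_single, ← map_mul]
      refine congrArg (fun z => indMk H.incl M m (toGR R G T (n.1 * z))) ?_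
      exact monoidAlgebraMap_single _ _ _ _
  exact ⟨ι, fun S m n => (hι S _).trans (hj S m n)⟩

end

section

/-! ### Morphisms out of a Mackey term -/

section SubgroupSections

variable {G : CondGrp.{u}} (H : CondSubgroup G)

/-- The inclusion of a condensed subgroup, on sections. -/
def CondSubgroup.coe (S : Stonean.{u}ᵒᵖ) : H.toCondGrp.obj.obj S →* G.obj.obj S :=
  (H.incl.hom.app S).hom

lemma CondSubgroup.exists_coe_eq {S : Stonean.{u}ᵒᵖ} {x : G.obj.obj S} (hx : x ∈ H.obj S) :
    ∃ h, H.coe S h = x := ⟨(⟨x, hx⟩ : H.obj S), rfl⟩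

lemma CondSubgroup.coe_mem {S : Stonean.{u}ᵒᵖ} (h : H.toCondGrp.obj.obj S) :
    H.coe S h ∈ H.obj S := Subtype.property (p := fun x => x ∈ H.obj S) h

lemma CondSubgroup.map_coe {S T : Stonean.{u}ᵒᵖ} (f : S ⟶ T) (h : H.toCondGrp.obj.obj S) :
    (G.obj.map f).hom (H.coe S h) = H.coe T ((H.toCondGrp.obj.map f).hom h) := rfl

end SubgroupSections

/-- As a left `k[H]`-module, `k[Hg]` is generated by `g`. The generator enters as any `e` with
underlying element `g`, so that no particular proof of membership is fixed. -/
lemma AddMonoidHom.eq_of_cosetSpan {k Γ : Type*} [Ring k] [Group Γ] {H : Subgroup Γ} {g : Γ}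
    {V : Type*} [AddCommGroup V] (f f' : cosetSpan k H g →+ V)
    (h : ∀ (x : H) (r : k) (e : cosetSpan k H g), e.1 = MonoidAlgebra.single g 1 →
      f ((MonoidAlgebra.single x r : MonoidAlgebra k H) • e) =
        f' ((MonoidAlgebra.single x r : MonoidAlgebra k H) • e)) : f = f' := by
  let e : cosetSpan k H g := ⟨MonoidAlgebra.single g 1, fun x hx => by
    have hx' := Finsupp.support_single_subset hx
    rw [Finset.mem_singleton.1 hx', mul_inv_cancel]
    exact H.one_mem⟩
  have hz (z : MonoidAlgebra k H) : f (z • e) = f' (z • e) := by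
    induction z using MonoidAlgebra.induction_linear with
    | zero => rw [zero_smul, map_zero, map_zero]
    | add a b ha hb => rw [add_smul, map_add, map_add, ha, hb]
    | single x r => exact h x r e rfl
  refine AddMonoidHom.ext fun n => ?_
  suffices ∃ z : MonoidAlgebra k H, subgroupRingHom k H z * MonoidAlgebra.single g 1 = n.1 by
    obtain ⟨z, hn⟩ := this
    rw [← show z • e = n from Subtype.ext hn, hz]
  obtain ⟨n, hn⟩ := n
  have hmem : n ∈ (subgroupRingHom k H).toAddMonoidHom.range.map
      (AddMonoidHom.mulRight (MonoidAlgebra.single g (1 : k))) := by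
    rw [← MonoidAlgebra.sum_coeff_single n]
    refine AddSubgroup.sum_mem _ fun x hx => ?_
    -- Each term `r x` of `n` equals `(r x g⁻¹) g`, and `x g⁻¹` lies in `H` by the support
    -- condition.
    refine ⟨_, ⟨MonoidAlgebra.single ⟨x * g⁻¹, hn x hx⟩ (n.coeff x), rfl⟩, ?_⟩
    change subgroupRingHom k H (MonoidAlgebra.single ⟨x * g⁻¹, hn x hx⟩ (n.coeff x)) *
      MonoidAlgebra.single g 1 = _
    rw [subgroupRingHom, monoidAlgebraMap_single, MonoidAlgebra.single_mul_single]
    simp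
  obtain ⟨_, ⟨z, rfl⟩, hz'⟩ := hmem
  exact ⟨z, hz'⟩

variable {R : CondRing.{u}} {G : CondGrp.{u}} (H K : CondSubgroup G) (g : CondGrp.underlying G)
  (M : RightMod (groupRing R H.toCondGrp))

variable (R) in
/-- The element `g` of `R(S)[H(S)g]`. -/
def cosetGen (S : Stonean.{u}ᵒᵖ) : CosetSec R H g S :=
  ⟨MonoidAlgebra.single (CondGrp.const G g S) 1, fun x hx => by
    have hx' := Finsupp.support_single_subset hx
    rw [Finset.mem_singleton.1 hx', mul_inv_cancel]
    exact (H.obj S).one_mem⟩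

lemma cosetRestr_cosetGen {S T : Stonean.{u}ᵒᵖ} (f : S ⟶ T) :
    cosetRestr R H g f (cosetGen R H g S) = cosetGen R H g T :=
  Subtype.ext ((monoidAlgebraMap_single _ _ _ _).trans
    (by rw [map_one]; exact congrArg (MonoidAlgebra.single · _) (CondGrp.map_const G g f)))

/-- The restriction to `K ∩ g⁻¹Hg` of `M ⊗_{R[H]} R[Hg]`. -/
abbrev mackeyRes : RightMod (groupRing R (K ⊓ H.conj g).toCondGrp) :=
  (res (groupRingMap R (CondSubgroup.inclOfLE
    (CondSubgroup.inf_le_right K (H.conj g))))).obj (tensor M (cosetBimod R H g))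

/-- The section `(m ⊗ n) ⊗ 1` of the Mackey term. -/
def mackeyMk {S : Stonean.{u}ᵒᵖ} (m : M.val.obj S) (n : CosetSec R H g S) :
    (mackeyTerm R H K M g).val.obj S :=
  indMk (CondSubgroup.inclOfLE (CondSubgroup.inf_le_left K (H.conj g))) (mackeyRes H K g M)
    (cosetTmk H g M m n) 1

lemma restr_mackeyMk {S T : Stonean.{u}ᵒᵖ} (f : S ⟶ T) (m : M.val.obj S)
    (n : CosetSec R H g S) : restr (mackeyTerm R H K M g) f (mackeyMk H K g M m n) =
      mackeyMk H K g M (restr M f m) (cosetRestr R H g f n) := by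
  refine (restr_indMk _ _ _ _ _).trans ?_
  rw [map_one]
  exact congrArg (fun z => indMk _ (mackeyRes H K g M) z 1) (restr_cosetTmk H g M f m n)

variable {H K g M} {P : RightMod (groupRing R K.toCondGrp)}

/-- Here `k = g⁻¹ h g` lies in `K ∩ g⁻¹Hg`, so it may cross both tensor signs: `(m r h ⊗ g) ⊗ 1 = (m
⊗ r h g) ⊗ 1 = (m ⊗ g r k) ⊗ 1 = (m ⊗ g) ⊗ r k`. This is the source of the twisting condition. -/
lemma mackeyMk_act_cosetGen {S : Stonean.{u}ᵒᵖ} (h : H.toCondGrp.obj.obj S)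
    (k : K.toCondGrp.obj.obj S) (r : R.obj.obj S) (m : M.val.obj S)
    (hk : H.coe S h * CondGrp.const G g S = CondGrp.const G g S * K.coe S k) :
    mackeyMk H K g M (act M (MonoidAlgebra.single h r) m) (cosetGen R H g S) =
      act (mackeyTerm R H K M g) (MonoidAlgebra.single k r)
        (mackeyMk H K g M m (cosetGen R H g S)) := by
  have hmem : K.coe S k ∈ (H.conj g).obj S := by
    change CondGrp.const G g S * K.coe S k * (CondGrp.const G g S)⁻¹ ∈ H.obj S
    rw [← hk, mul_inv_cancel_right]
    exact H.coe_mem h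
  let c : (K ⊓ H.conj g).toCondGrp.obj.obj S :=
    (⟨K.coe S k, K.coe_mem k, hmem⟩ : (K ⊓ H.conj g).obj S)
  have e₁ : grMap R (CondSubgroup.inclOfLE (CondSubgroup.inf_le_left K (H.conj g))) S
      (MonoidAlgebra.single c r) = MonoidAlgebra.single k r := grMap_single _ _ _
  have e₂ : act (mackeyRes H K g M) (MonoidAlgebra.single c r)
      (cosetTmk H g M m (cosetGen R H g S)) =
      cosetTmk H g M (act M (MonoidAlgebra.single h r) m) (cosetGen R H g S) := by
    refine (act_res _ (tensor M (cosetBimod R H g)) _ _).trans ?_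
    rw [grMap_single, act_cosetTmk, cosetTmk_act]
    refine congrArg (cosetTmk H g M m) (Subtype.ext ?_)
    refine (coe_op_smul_cosetSpan _ _).trans (Eq.trans ?_ (coe_smul_cosetSpan _ _).symm)
    refine (congrArg (_ * ·) (monoidAlgebraMap_single _ _ _ _)).trans
      (Eq.trans ?_ (congrArg (· * _) (monoidAlgebraMap_single _ _ _ _)).symm)
    refine (MonoidAlgebra.single_mul_single _ _ _ _).trans
      (Eq.trans ?_ (MonoidAlgebra.single_mul_single _ _ _ _).symm)
    rw [one_mul, mul_one]
    exact congrArg (MonoidAlgebra.single · r) hk.symm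
  -- Balancedness over `R[K ∩ g⁻¹Hg]` carries `r c` across the outer tensor sign.
  have e₃ := indMk_act (CondSubgroup.inclOfLE (CondSubgroup.inf_le_left K (H.conj g)))
    (mackeyRes H K g M) (cosetTmk H g M m (cosetGen R H g S)) (MonoidAlgebra.single c r) 1
  rw [e₁, mul_one, e₂] at e₃
  refine e₃.trans (Eq.trans ?_ (act_indMk _ _ _ _ _).symm)
  rw [one_mul]

/-- A natural family of additive maps `δ : M → P` such that `δ (m h) = δ (m) k`
if `h g = g k`. -/
structure TwistedHom (M : RightMod (groupRing R H.toCondGrp))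
    (P : RightMod (groupRing R K.toCondGrp)) (g : CondGrp.underlying G)
    extends NatAddHom M P where
  twist {S : Stonean.{u}ᵒᵖ} (h : H.toCondGrp.obj.obj S) (k : K.toCondGrp.obj.obj S)
    (r : R.obj.obj S) (m : M.val.obj S)
    (hk : H.coe S h * CondGrp.const G g S = CondGrp.const G g S * K.coe S k) :
    app S (act M (MonoidAlgebra.single h r) m) = act P (MonoidAlgebra.single k r) (app S m)

/-- The restriction of a morphism to the sections `(m ⊗ g) ⊗ 1`. -/
def TwistedHom.ofHom (γ : mackeyTerm R H K M g ⟶ P) : TwistedHom M P g where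
  app S := AddMonoidHom.mk' (fun m => γ.val.app S (mackeyMk H K g M m (cosetGen R H g S)))
    fun m m' => by
      refine (congrArg (γ.val.app S) ?_).trans (map_add (γ.val.app S).hom _ _)
      refine (congrArg (fun z => indMk _ (mackeyRes H K g M) z 1)
        (cosetTmk_add_left H g M m m' _)).trans ?_
      exact indMk_add_left _ _ _ _ _
  naturality f m := by
    refine Eq.trans ?_ (RightMod.hom_restr γ f _)
    rw [restr_mackeyMk, cosetRestr_cosetGen]
    rfl
  twist h k r m hk :=
    (congrArg (γ.val.app _) (mackeyMk_act_cosetGen h k r m hk)).trans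
      (RightMod.hom_map_smul γ _ _)

/-- Morphisms out of a Mackey term are determined by their values on the sections
`(m ⊗ g) ⊗ 1`. -/
lemma mackeyTerm_hom_ext {γ γ' : mackeyTerm R H K M g ⟶ P}
    (h : ∀ S (m : M.val.obj S), γ.val.app S (mackeyMk H K g M m (cosetGen R H g S)) =
      γ'.val.app S (mackeyMk H K g M m (cosetGen R H g S))) : γ = γ' := by
  let F (γ : mackeyTerm R H K M g ⟶ P) : NatAddHom (tensor M (cosetBimod R H g)) P :=
    { app S := AddMonoidHom.mk' (fun t => γ.val.app S (indMk
        (CondSubgroup.inclOfLE (CondSubgroup.inf_le_left K (H.conj g))) (mackeyRes H K g M) t 1))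
        fun t t' => (congrArg (γ.val.app S) (indMk_add_left _ (mackeyRes H K g M) t t' 1)).trans
          (map_add (γ.val.app S).hom _ _)
      naturality f t := by
        refine Eq.trans ?_ (RightMod.hom_restr γ f _)
        refine congrArg (γ.val.app _) (Eq.trans ?_ (restr_indMk _ (mackeyRes H K g M) f t 1).symm)
        rw [map_one]
        rfl }
  refine ind_hom_ext fun S t => ?_
  refine natAddHom_ext_cosetTmk (F := F γ) (F' := F γ') (fun S m n => ?_) S t
  let V (γ : mackeyTerm R H K M g ⟶ P) : CosetSec R H g S →+ P.val.obj S :=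
    AddMonoidHom.mk' (fun n => (F γ).app S (cosetTmk H g M m n)) fun n n' => by
      rw [cosetTmk_add_right, map_add]
  refine DFunLike.congr_fun (AddMonoidHom.eq_of_cosetSpan (V γ) (V γ') fun x r e he => ?_) n
  obtain rfl : e = cosetGen R H g S := Subtype.ext he
  have e₁ := cosetTmk_act H g M m (MonoidAlgebra.single x r) (cosetGen R H g S)
  refine (congrArg ((F γ).app S) e₁).symm.trans (Eq.trans ?_ (congrArg ((F γ').app S) e₁))
  exact h S _

end

section

variable {R : CondRing.{u}} {G : CondGrp.{u}} {H K : CondSubgroup G}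
  {rep : H.DoubleCosets K → CondGrp.underlying G}

/-! ### Local decomposition of the sections of `G` into double cosets -/

lemma CondGrp.const_pt (g : CondGrp.underlying G) : CondGrp.const G g (op pt) = g := by
  simp only [CondGrp.const, toPt_pt]
  exact ConcreteCategory.congr_hom (G.obj.map_id (op pt)) g

lemma CondGrp.const_mul (g g' : CondGrp.underlying G) (S : Stonean.{u}ᵒᵖ) :
    CondGrp.const G (g * g') S = CondGrp.const G g S * CondGrp.const G g' S :=
  map_mul (G.obj.map (toPt S.unop).op).hom g g'

lemma CondGrp.map_comp_apply {S T U : Stonean.{u}} (f : T ⟶ S) (f' : U ⟶ T)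
    (x : G.obj.obj (op S)) : (G.obj.map (f' ≫ f).op).hom x =
      (G.obj.map f'.op).hom ((G.obj.map f.op).hom x) :=
  ConcreteCategory.congr_hom (G.obj.map_comp f.op f'.op) x

lemma CondSubgroup.const_mem {g : CondGrp.underlying G} (hg : g ∈ H.obj (op pt))
    (S : Stonean.{u}ᵒᵖ) : CondGrp.const G g S ∈ H.obj S := H.map_mem _ hg

variable (H K rep) in
/-- The sieve of the maps along which `x` becomes of the form `h g k`, where `g` is one of the
representatives. -/
def decompSieve {S : Stonean.{u}} (x : G.obj.obj (op S)) : Sieve S where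
  arrows T f := ∃ (d : H.DoubleCosets K) (h : H.toCondGrp.obj.obj (op T))
    (k : K.toCondGrp.obj.obj (op T)), (G.obj.map f.op).hom x =
      H.coe _ h * CondGrp.const G (rep d) (op T) * K.coe _ k
  downward_closed := by
    rintro T U f ⟨d, h, k, e⟩ f'
    refine ⟨d, (H.toCondGrp.obj.map f'.op).hom h, (K.toCondGrp.obj.map f'.op).hom k, ?_⟩
    rw [CondGrp.map_comp_apply, e, map_mul, map_mul, CondGrp.map_const]
    rfl

/-- The open set representing the pullback of `H` along `y` contains `s`, and clopen sets form a
basis of `S`. -/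
lemma CondSubgroup.IsOpen.exists_clopen (hH : H.IsOpen) {S : Stonean.{u}} (y : G.obj.obj (op S))
    (s : S) (hy : (G.obj.map (pointMap S s).op).hom y ∈ H.obj (op pt)) :
    ∃ (V : Set S) (hV : IsClopen V), s ∈ V ∧
      (G.obj.map (clopenIncl S V hV).op).hom y ∈ H.obj (op (clopen S V hV)) := by
  obtain ⟨U, hU, h⟩ := hH S y
  obtain ⟨V, hV, hs, hVU⟩ := exists_clopen_subset hU ((h _ _).1 hy PUnit.unit)
  exact ⟨V, hV, hs, (h _ _).2 fun t => hVU (clopenIncl_mem S V hV t)⟩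

variable (hHK : H.IsOpen ∨ K.IsOpen)
  (hrep : ∀ d, DoubleCoset.mk (H.obj (op pt)) (K.obj (op pt)) (rep d) = d)

include hHK hrep in
-- The only use of openness by itself. With `g` the value of `x` at a point, `x` differs from the
-- constant section `g` by a section of the open subgroup near that point.
lemma decompSieve_mem {S : Stonean.{u}} (x : G.obj.obj (op S)) :
    decompSieve H K rep x ∈ topo S := by
  refine mem_topo_of_clopen _ fun s => ?_
  let g : CondGrp.underlying G := (G.obj.map (pointMap S s).op).hom x
  have hg : (G.obj.map (pointMap S s).op).hom x = g := rfl
  have key : ∃ (V : Set S) (hV : IsClopen V), s ∈ V ∧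
      ∃ a ∈ H.obj (op (clopen S V hV)), ∃ b ∈ K.obj (op (clopen S V hV)),
        (G.obj.map (clopenIncl S V hV).op).hom x = a * CondGrp.const G g _ * b := by
    -- If `H` is open, take `a = x g⁻¹` and `b = 1`; if `K` is open, take `a = 1` and `b = g⁻¹ x`.
    rcases hHK with hH | hK
    · obtain ⟨V, hV, hs, hx⟩ := hH.exists_clopen (x * (CondGrp.const G g (op S))⁻¹) s (by
        rw [map_mul, map_inv, CondGrp.map_const, CondGrp.const_pt, hg, mul_inv_cancel]
        exact one_mem _)
      refine ⟨V, hV, hs, _, hx, 1, one_mem _, ?_⟩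
      rw [map_mul, map_inv, CondGrp.map_const, inv_mul_cancel_right, mul_one]
    · obtain ⟨V, hV, hs, hx⟩ := hK.exists_clopen ((CondGrp.const G g (op S))⁻¹ * x) s (by
        rw [map_mul, map_inv, CondGrp.map_const, CondGrp.const_pt, hg, inv_mul_cancel]
        exact one_mem _)
      refine ⟨V, hV, hs, 1, one_mem _, _, hx, ?_⟩
      rw [map_mul, map_inv, CondGrp.map_const, one_mul, mul_inv_cancel_left]
  obtain ⟨V, hV, hs, a, ha, b, hb, e⟩ := key
  refine ⟨V, hV, hs, ?_⟩
  -- This writes `g` as `a'` times its representative times `b'`; the constants `a'` and `b'` are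
  -- absorbed into `a` and `b`.
  obtain ⟨a', ha', b', hb', e'⟩ := (DoubleCoset.eq _ _ _ _).1
    (hrep (DoubleCoset.mk (H.obj (op pt)) (K.obj (op pt)) g))
  obtain ⟨h, hh⟩ := H.exists_coe_eq (mul_mem ha (H.const_mem ha' (op (clopen S V hV))))
  obtain ⟨k, hk⟩ := K.exists_coe_eq (mul_mem (K.const_mem hb' (op (clopen S V hV))) hb)
  refine ⟨DoubleCoset.mk (H.obj (op pt)) (K.obj (op pt)) g, h, k, ?_⟩
  rw [e, hh, hk]
  -- The element `g` also occurs on the right, inside the chosen representative, and must stay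
  -- there.
  conv_lhs => rw [e']
  rw [CondGrp.const_mul, CondGrp.const_mul]
  simp only [mul_assoc]

include hrep in
-- Restricting the equation to the point `s` turns it into one in `G(*)`. The point is essential:
-- over the empty space all sections coincide.
lemma doubleCoset_eq {S : Stonean.{u}} (s : S) {d d' : H.DoubleCosets K}
    {h h' : H.toCondGrp.obj.obj (op S)} {k k' : K.toCondGrp.obj.obj (op S)}
    (e : H.coe _ h * CondGrp.const G (rep d) (op S) * K.coe _ k =
      H.coe _ h' * CondGrp.const G (rep d') (op S) * K.coe _ k') : d = d' := by
  have e' := congrArg (G.obj.map (pointMap S s).op).hom e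
  simp only [map_mul, CondGrp.map_const, CondGrp.const_pt, CondSubgroup.map_coe] at e'
  rw [← hrep d, ← hrep d']
  refine (DoubleCoset.eq _ _ _ _).2 ⟨_, mul_mem (inv_mem (H.coe_mem
    ((H.toCondGrp.obj.map (pointMap S s).op).hom h'))) (H.coe_mem
    ((H.toCondGrp.obj.map (pointMap S s).op).hom h)), _, mul_mem (K.coe_mem
    ((K.toCondGrp.obj.map (pointMap S s).op).hom k)) (inv_mem (K.coe_mem
    ((K.toCondGrp.obj.map (pointMap S s).op).hom k'))), ?_⟩
  have e₂ := eq_mul_inv_of_mul_eq e'.symm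
  have e₃ := eq_inv_mul_of_mul_eq e₂
  refine e₃.trans ?_
  simp only [mul_assoc]

/-! ### Gluing twisted maps -/

variable {M : RightMod (groupRing R H.toCondGrp)} {P : RightMod (groupRing R K.toCondGrp)}
  (δ : ∀ d, TwistedHom M P (rep d))

/-- The value at `(m, h g k)` of the glued map. -/
def twistedVal {S : Stonean.{u}ᵒᵖ} (m : M.val.obj S) (d : H.DoubleCosets K)
    (h : H.toCondGrp.obj.obj S) (k : K.toCondGrp.obj.obj S) : P.val.obj S :=
  act P (MonoidAlgebra.single k 1) ((δ d).app S (act M (MonoidAlgebra.single h 1) m))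

lemma restr_twistedVal {S T : Stonean.{u}ᵒᵖ} (f : S ⟶ T) (m : M.val.obj S)
    (d : H.DoubleCosets K) (h : H.toCondGrp.obj.obj S) (k : K.toCondGrp.obj.obj S) :
    restr P f (twistedVal δ m d h k) = twistedVal δ (restr M f m) d
      ((H.toCondGrp.obj.map f).hom h) ((K.toCondGrp.obj.map f).hom k) := by
  rw [twistedVal, restr_act, ← (δ d).naturality, restr_act, grRestr_single, grRestr_single,
    map_one]
  rfl

include hrep in
-- If `h g k = h' g k'`, then `(h'⁻¹ h) g = g (k' k⁻¹)`, and the twisting condition gives `δ(m h) k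
-- = δ(m h' (h'⁻¹ h)) k = δ(m h') k' k⁻¹ k = δ(m h') k'`.
lemma twistedVal_eq {S : Stonean.{u}} (m : M.val.obj (op S)) {d d' : H.DoubleCosets K}
    {h h' : H.toCondGrp.obj.obj (op S)} {k k' : K.toCondGrp.obj.obj (op S)}
    (e : H.coe _ h * CondGrp.const G (rep d) (op S) * K.coe _ k =
      H.coe _ h' * CondGrp.const G (rep d') (op S) * K.coe _ k') :
    twistedVal δ m d h k = twistedVal δ m d' h' k' := by
  -- Over the empty space `d` and `d'` may differ, but there `P` has only one section.
  rcases isEmpty_or_nonempty S with hS | ⟨⟨s⟩⟩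
  · exact P.subsingleton_of_isEmpty _ _
  · obtain rfl := doubleCoset_eq hrep s e
    have e₁ : H.coe _ (h'⁻¹ * h) * CondGrp.const G (rep d) (op S) =
        CondGrp.const G (rep d) (op S) * K.coe _ (k' * k⁻¹) := by
      rw [map_mul, map_inv, map_mul, map_inv]
      have e₂ := eq_mul_inv_of_mul_eq e
      rw [mul_assoc, inv_mul_eq_iff_eq_mul, e₂]
      simp only [mul_assoc]
    have e₃ : act M (MonoidAlgebra.single h 1) m =
        act M (MonoidAlgebra.single (h'⁻¹ * h) 1) (act M (MonoidAlgebra.single h' 1) m) := by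
      rw [← act_mul, MonoidAlgebra.single_mul_single, mul_inv_cancel_left, one_mul]
    rw [twistedVal, e₃, (δ d).twist _ _ _ _ e₁, ← act_mul, MonoidAlgebra.single_mul_single,
      inv_mul_cancel_right, one_mul]
    rfl

include hHK hrep in
-- The local values `δ(m h) k` glue: decompositions exist on a cover by `decompSieve_mem`, and the
-- value does not depend on the decomposition by `twistedVal_eq`.
lemma exists_glued {S : Stonean.{u}} (m : M.val.obj (op S)) (x : G.obj.obj (op S)) :
    ∃ p : P.val.obj (op S), ∀ ⦃T : Stonean.{u}⦄ (f : T ⟶ S) (d : H.DoubleCosets K)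
      (h : H.toCondGrp.obj.obj (op T)) (k : K.toCondGrp.obj.obj (op T)),
      (G.obj.map f.op).hom x = H.coe _ h * CondGrp.const G (rep d) (op T) * K.coe _ k →
        restr P f.op p = twistedVal δ (restr M f.op m) d h k := by
  let r ⦃T : Stonean.{u}⦄ (f : T ⟶ S) (p : P.val.obj (op T)) : Prop :=
    ∃ (d : H.DoubleCosets K) (h : H.toCondGrp.obj.obj (op T)) (k : K.toCondGrp.obj.obj (op T)),
      (G.obj.map f.op).hom x = H.coe _ h * CondGrp.const G (rep d) (op T) * K.coe _ k ∧
        twistedVal δ (restr M f.op m) d h k = p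
  have h₁ : ∀ ⦃T U : Stonean.{u}⦄ (f : T ⟶ S) (g : U ⟶ T) (p : P.val.obj (op T)), r f p →
      r (g ≫ f) (restr P g.op p) := by
    rintro T U f g _ ⟨d, h, k, e, rfl⟩
    refine ⟨d, (H.toCondGrp.obj.map g.op).hom h, (K.toCondGrp.obj.map g.op).hom k, ?_, ?_⟩
    · rw [CondGrp.map_comp_apply, e, map_mul, map_mul, CondGrp.map_const]
      rfl
    · rw [restr_twistedVal, RightMod.restr_op_comp]
  have h₂ : ∀ ⦃T : Stonean.{u}⦄ (f : T ⟶ S) (p q : P.val.obj (op T)), r f p → r f q → p = q := by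
    rintro T f _ _ ⟨d, h, k, e, rfl⟩ ⟨d', h', k', e', rfl⟩
    exact twistedVal_eq hrep δ _ (e.symm.trans e')
  obtain ⟨p, hp⟩ := P.exists_glue r h₁ h₂ (decompSieve_mem hHK hrep x)
    fun T f ⟨d, h, k, e⟩ => ⟨_, d, h, k, e, rfl⟩
  exact ⟨p, fun T f d h k e => hp f _ ⟨d, h, k, e, rfl⟩⟩

/-- The glued map `M(S) × G(S) → P(S)`. -/
def glued {S : Stonean.{u}} (m : M.val.obj (op S)) (x : G.obj.obj (op S)) : P.val.obj (op S) :=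
  (exists_glued hHK hrep δ m x).choose

lemma restr_glued_eq {S T : Stonean.{u}} (m : M.val.obj (op S)) (x : G.obj.obj (op S))
    (f : T ⟶ S) {d : H.DoubleCosets K} {h : H.toCondGrp.obj.obj (op T)}
    {k : K.toCondGrp.obj.obj (op T)}
    (e : (G.obj.map f.op).hom x = H.coe _ h * CondGrp.const G (rep d) (op T) * K.coe _ k) :
    restr P f.op (glued hHK hrep δ m x) = twistedVal δ (restr M f.op m) d h k :=
  (exists_glued hHK hrep δ m x).choose_spec f d h k e

lemma glued_eq {S : Stonean.{u}} (m : M.val.obj (op S)) (x : G.obj.obj (op S))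
    (q : P.val.obj (op S))
    (hq : ∀ ⦃T : Stonean.{u}⦄ (f : T ⟶ S) (d : H.DoubleCosets K)
      (h : H.toCondGrp.obj.obj (op T)) (k : K.toCondGrp.obj.obj (op T)),
      (G.obj.map f.op).hom x = H.coe _ h * CondGrp.const G (rep d) (op T) * K.coe _ k →
        restr P f.op (glued hHK hrep δ m x) = restr P f.op q) : glued hHK hrep δ m x = q :=
  P.ext_of_cover (decompSieve_mem hHK hrep x) fun _ f ⟨d, h, k, e⟩ => hq f d h k e

lemma glued_add {S : Stonean.{u}} (m m' : M.val.obj (op S)) (x : G.obj.obj (op S)) :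
    glued hHK hrep δ (m + m') x = glued hHK hrep δ m x + glued hHK hrep δ m' x := by
  refine glued_eq hHK hrep δ _ x _ fun T f d h k e => ?_
  rw [map_add, restr_glued_eq hHK hrep δ _ _ f e, restr_glued_eq hHK hrep δ _ _ f e,
    restr_glued_eq hHK hrep δ _ _ f e, map_add, twistedVal, act_add_right, map_add,
    act_add_right]
  rfl

lemma restr_glued {S T : Stonean.{u}} (f : T ⟶ S) (m : M.val.obj (op S)) (x : G.obj.obj (op S)) :
    glued hHK hrep δ (restr M f.op m) ((G.obj.map f.op).hom x) =
      restr P f.op (glued hHK hrep δ m x) := by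
  refine glued_eq hHK hrep δ _ _ _ fun U f' d h k e => ?_
  rw [restr_glued_eq hHK hrep δ _ _ f' e, ← RightMod.restr_op_comp, ← RightMod.restr_op_comp,
    restr_glued_eq hHK hrep δ _ _ (f' ≫ f) ((CondGrp.map_comp_apply f f' x).trans e)]

/-- A local decomposition `x = h g k` gives `h₀ x = (h₀ h) g k`, and both sides become `δ(m h₀ h)
k`. -/
lemma glued_act_left {S : Stonean.{u}} (h₀ : H.toCondGrp.obj.obj (op S)) (m : M.val.obj (op S))
    (x : G.obj.obj (op S)) : glued hHK hrep δ (act M (MonoidAlgebra.single h₀ 1) m) x =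
      glued hHK hrep δ m (H.coe _ h₀ * x) := by
  refine glued_eq hHK hrep δ _ x _ fun T f d h k e => ?_
  have e' : (G.obj.map f.op).hom (H.coe _ h₀ * x) =
      H.coe _ ((H.toCondGrp.obj.map f.op).hom h₀ * h) * CondGrp.const G (rep d) (op T) *
        K.coe _ k := by
    rw [map_mul, e, map_mul, CondSubgroup.map_coe]
    simp only [mul_assoc]
  rw [restr_glued_eq hHK hrep δ _ _ f e, restr_glued_eq hHK hrep δ _ _ f e', twistedVal,
    twistedVal, restr_act, grRestr_single, map_one, ← act_mul, MonoidAlgebra.single_mul_single,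
    one_mul]

lemma glued_act_right {S : Stonean.{u}} (k₀ : K.toCondGrp.obj.obj (op S)) (m : M.val.obj (op S))
    (x : G.obj.obj (op S)) : glued hHK hrep δ m (x * K.coe _ k₀) =
      act P (MonoidAlgebra.single k₀ 1) (glued hHK hrep δ m x) := by
  refine P.ext_of_cover (decompSieve_mem hHK hrep x) fun T f ⟨d, h, k, e⟩ => ?_
  have e' : (G.obj.map f.op).hom (x * K.coe _ k₀) =
      H.coe _ h * CondGrp.const G (rep d) (op T) *
        K.coe _ (k * (K.toCondGrp.obj.map f.op).hom k₀) := by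
    rw [map_mul, e, map_mul, CondSubgroup.map_coe]
    simp only [mul_assoc]
  rw [restr_act, restr_glued_eq hHK hrep δ _ _ f e, restr_glued_eq hHK hrep δ _ _ f e',
    twistedVal, twistedVal, grRestr_single, map_one, ← act_mul, MonoidAlgebra.single_mul_single,
    one_mul]

/-- Scalars commute with group elements in both group rings, even if `R` is not commutative, and the
twisting condition with `h = k = 1` makes `δ` compatible with scalars. -/
lemma glued_act_scalar {S : Stonean.{u}} (r : R.obj.obj (op S)) (m : M.val.obj (op S))
    (x : G.obj.obj (op S)) : glued hHK hrep δ (act M (MonoidAlgebra.single 1 r) m) x =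
      act P (MonoidAlgebra.single 1 r) (glued hHK hrep δ m x) := by
  refine glued_eq hHK hrep δ _ x _ fun T f d h k e => ?_
  rw [restr_act, restr_glued_eq hHK hrep δ _ _ f e, restr_glued_eq hHK hrep δ _ _ f e,
    twistedVal, twistedVal, restr_act, grRestr_single, grRestr_single, map_one, map_one]
  have e₁ : act M (MonoidAlgebra.single h 1)
      (act M (MonoidAlgebra.single 1 ((R.obj.map f.op).hom r)) (restr M f.op m)) =
      act M (MonoidAlgebra.single 1 ((R.obj.map f.op).hom r))
        (act M (MonoidAlgebra.single h 1) (restr M f.op m)) := by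
    rw [← act_mul, ← act_mul, MonoidAlgebra.single_mul_single, MonoidAlgebra.single_mul_single,
      one_mul, mul_one, mul_one, one_mul]
  rw [e₁, (δ d).twist 1 1 _ _ (by rw [map_one, map_one, one_mul, mul_one]), ← act_mul, ← act_mul,
    MonoidAlgebra.single_mul_single, MonoidAlgebra.single_mul_single, one_mul, mul_one, mul_one,
    one_mul]

lemma glued_rep {S : Stonean.{u}} (m : M.val.obj (op S)) (d : H.DoubleCosets K) :
    glued hHK hrep δ m (CondGrp.const G (rep d) (op S)) = (δ d).app (op S) m := by
  refine P.ext_of_cover (topo.top_mem _) fun T f _ => ?_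
  -- The constant section is decomposed everywhere, with trivial factors in `H` and `K`.
  rw [restr_glued_eq hHK hrep δ (d := d) (h := 1) (k := 1) m _ f
    (by rw [CondGrp.map_const, map_one, map_one, one_mul, mul_one]), twistedVal,
    ← MonoidAlgebra.one_def, act_one, ← MonoidAlgebra.one_def, act_one, (δ d).naturality]

end

section

variable {R : CondRing.{u}}

/-! ### Maps out of induced modules -/

section Ind

variable {Γ G : CondGrp.{u}} {i : Γ ⟶ G} {M : RightMod (groupRing R Γ)}

lemma exists_cover_regular {S : Stonean.{u}} (n : (regular (groupRing R G)).val.obj (op S)) :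
    ∃ C ∈ topo S, ∀ ⦃T : Stonean.{u}⦄ (f : T ⟶ S), C f →
      ∃ a, toGR R G (op T) a = restr (regular (groupRing R G)) f.op n :=
  exists_cover_toGR (show (groupRing R G).obj.obj (op S) from n)

lemma indMk_add_right {S : Stonean.{u}ᵒᵖ} (m : M.val.obj S) (b b' : (groupRing R G).obj.obj S) :
    indMk i M m (b + b') = indMk i M m b + indMk i M m b' := tmk_add_right _ _ _ _ _

lemma indMk_zero_right {S : Stonean.{u}ᵒᵖ} (m : M.val.obj S) :
    indMk i M m (0 : (groupRing R G).obj.obj S) = 0 :=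
  map_zero (tmkHom M (Bimod.ofHom (groupRingMap R i)) S m)

/-- Additive maps out of an induced module are determined by their values on the sections
`m ⊗ x`, where `x` is a section of the group. -/
lemma natAddHom_ext_indMk {D : CondRing.{u}} {Q : RightMod D} {F F' : NatAddHom (ind R i M) Q}
    (h : ∀ S m x, F.app S (indMk i M m (toGR R G S (MonoidAlgebra.single x 1))) =
      F'.app S (indMk i M m (toGR R G S (MonoidAlgebra.single x 1))))
    (S : Stonean.{u}ᵒᵖ) (t : (ind R i M).val.obj S) : F.app S t = F'.app S t := by
  have h₁ S (m : M.val.obj S) (a : MonoidAlgebra (R.obj.obj S) (G.obj.obj S)) :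
      F.app S (indMk i M m (toGR R G S a)) = F'.app S (indMk i M m (toGR R G S a)) := by
    induction a using MonoidAlgebra.induction_linear with
    | zero => rw [map_zero, indMk_zero_right, map_zero, map_zero]
    | add a b ha hb => rw [map_add, indMk_add_right, map_add, map_add, ha, hb]
    | single x r =>
      -- The scalar `r` comes from `R[Γ]`, so it can be moved from `r x` to the factor `m`.
      have hr : toGR R G S (MonoidAlgebra.single x r) =
          toGR R G S (grMap R i S (MonoidAlgebra.single 1 r)) *
            toGR R G S (MonoidAlgebra.single x 1) := by
        rw [grMap_single, map_one, ← map_mul, MonoidAlgebra.single_mul_single, one_mul, mul_one]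
      rw [hr, ← indMk_act, h]
  refine NatAddHom.ext_tmk (fun S m n => ?_) S t
  obtain ⟨C, hC, hc⟩ := exists_cover_regular (S := S.unop) n
  refine RightMod.ext_of_cover Q (S := S.unop) hC fun T f hf => ?_
  obtain ⟨n₀, hn₀⟩ := hc f hf
  refine (F.naturality f.op _).symm.trans (Eq.trans ?_ (F'.naturality f.op _))
  have e : restr (tensor M (Bimod.ofHom (groupRingMap R i))) f.op
      (tmk M (Bimod.ofHom (groupRingMap R i)) m n) =
        indMk i M (restr M f.op m) (toGR R G (op T) n₀) :=
    (restr_tmk _ _ _ _ _).trans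
      (congrArg (tmk M (Bimod.ofHom (groupRingMap R i)) _) hn₀.symm)
  exact (congrArg (F.app (op T)) e).trans ((h₁ _ _ _).trans (congrArg (F'.app (op T)) e).symm)

/-- Compatibility with the action of the group ring may be checked on the sections `m ⊗ r x`,
where `x` is a section of the group. -/
lemma NatAddHom.map_act_of_indMk {Δ : CondGrp.{u}} {Q : RightMod (groupRing R Δ)}
    (F : NatAddHom (ind R i M) Q) {S : Stonean.{u}ᵒᵖ}
    (c : MonoidAlgebra (R.obj.obj S) (G.obj.obj S))
    (d : MonoidAlgebra (R.obj.obj S) (Δ.obj.obj S))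
    (h : ∀ ⦃T : Stonean.{u}ᵒᵖ⦄ (f : S ⟶ T) (m : M.val.obj T) (x : G.obj.obj T)
      (r : R.obj.obj T),
      F.app T (indMk i M m (toGR R G T (MonoidAlgebra.single x r * grRestr R G f c))) =
        act Q (grRestr R Δ f d)
          (F.app T (indMk i M m (toGR R G T (MonoidAlgebra.single x r)))))
    (t : (ind R i M).val.obj S) : F.app S (act _ c t) = act Q d (F.app S t) := by
  have h₁ ⦃T : Stonean.{u}ᵒᵖ⦄ (f : S ⟶ T) (m : M.val.obj T)
      (a : MonoidAlgebra (R.obj.obj T) (G.obj.obj T)) :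
      F.app T (indMk i M m (toGR R G T (a * grRestr R G f c))) =
        act Q (grRestr R Δ f d) (F.app T (indMk i M m (toGR R G T a))) := by
    induction a using MonoidAlgebra.induction_linear with
    | zero => rw [zero_mul, map_zero, indMk_zero_right, map_zero, act_zero_right]
    | add a b ha hb =>
      rw [add_mul, map_add, map_add, indMk_add_right, indMk_add_right, map_add, map_add, ha, hb,
        act_add_right]
    | single x r => exact h f m x r
  refine F.map_smul_of_tmk (S := S.unop) _ _ (fun T f m n => ?_) t
  obtain ⟨C, hC, hc⟩ := exists_cover_regular n
  refine RightMod.ext_of_cover Q hC fun U f' hf' => ?_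
  obtain ⟨n₀, hn₀⟩ := hc f' hf'
  refine (F.naturality f'.op _).symm.trans ?_
  have e₁ : ((groupRing R G).obj.map f'.op).hom
      (((groupRing R G).obj.map f.op).hom (toGR R G S c)) =
      toGR R G (op U) (grRestr R G (f.op ≫ f'.op) c) := by
    rw [toGR_grRestr, Functor.map_comp]; rfl
  have e₂ : ((groupRing R Δ).obj.map f'.op).hom
      (((groupRing R Δ).obj.map f.op).hom (toGR R Δ S d)) =
      toGR R Δ (op U) (grRestr R Δ (f.op ≫ f'.op) d) := by
    rw [toGR_grRestr, Functor.map_comp]; rfl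
  have e₃ : restr (tensor M (Bimod.ofHom (groupRingMap R i))) f'.op
      (tmk M (Bimod.ofHom (groupRingMap R i)) m n) =
        indMk i M (restr M f'.op m) (toGR R G (op U) n₀) :=
    (restr_tmk _ _ _ _ _).trans
      (congrArg (tmk M (Bimod.ofHom (groupRingMap R i)) _) hn₀.symm)
  have e₄ : restr (tensor M (Bimod.ofHom (groupRingMap R i))) f'.op
      (MulOpposite.op (((groupRing R G).obj.map f.op).hom (toGR R G S c)) •
        tmk M (Bimod.ofHom (groupRingMap R i)) m n) =
        indMk i M (restr M f'.op m) (toGR R G (op U) (n₀ * grRestr R G (f.op ≫ f'.op) c)) := by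
    rw [RightMod.restr_smul, e₁, e₃, map_mul]
    exact smul_indMk i M _ _ _
  have e₅ := (F.naturality f'.op (tmk M (Bimod.ofHom (groupRingMap R i)) m n)).symm.trans
    (congrArg (F.app (op U)) e₃)
  refine (congrArg (F.app (op U)) ((congrArg (restr (ind R i M) f'.op)
    (smul_tmk _ _ _ _ _).symm).trans e₄)).trans ((h₁ _ _ _).trans ?_)
  rw [RightMod.restr_smul, e₂]
  exact congrArg (act Q (grRestr R Δ (f.op ≫ f'.op) d)) e₅.symm

/-- Additive maps out of an induced module. -/
lemma exists_natAddHom_ind {D : CondRing.{u}} {Q : RightMod D}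
    (b : ∀ S, M.val.obj S → G.obj.obj S → Q.val.obj S)
    (hadd : ∀ S m m' x, b S (m + m') x = b S m x + b S m' x)
    (hnat : ∀ {S T : Stonean.{u}ᵒᵖ} (f : S ⟶ T) (m : M.val.obj S) (x : G.obj.obj S),
      b T (restr M f m) ((G.obj.map f).hom x) = restr Q f (b S m x))
    (hbal : ∀ (S : Stonean.{u}ᵒᵖ) (h : Γ.obj.obj S) (m : M.val.obj S) (x : G.obj.obj S),
      b S (act M (MonoidAlgebra.single h 1) m) x = b S m ((i.hom.app S).hom h * x)) :
    ∃ F : NatAddHom (ind R i M) Q, ∀ S m (x : G.obj.obj S) (r : R.obj.obj S),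
      F.app S (indMk i M m (toGR R G S (MonoidAlgebra.single x r))) =
        b S (act M (MonoidAlgebra.single 1 r) m) x := by
  let c (S : Stonean.{u}ᵒᵖ) (m : M.val.obj S) (x : G.obj.obj S) :
      R.obj.obj S →+ Q.val.obj S :=
    AddMonoidHom.mk' (fun r => b S (act M (MonoidAlgebra.single 1 r) m) x) fun r r' => by
      rw [MonoidAlgebra.single_add, act_add, hadd]
  -- On `R(S)[G(S)]` the map sends `(m, ∑ r x)` to `∑ b(m r, x)`; it is then extended to `R[G]`.
  let β (S : Stonean.{u}ᵒᵖ) : M.val.obj S →+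
      MonoidAlgebra (R.obj.obj S) (G.obj.obj S) →+ Q.val.obj S :=
    AddMonoidHom.mk' (fun m => (Finsupp.liftAddHom (c S m)).comp
      MonoidAlgebra.coeffAddEquiv.toAddMonoidHom) fun m m' => by
        have hc x : c S (m + m') x = c S m x + c S m' x := AddMonoidHom.ext fun r =>
          (congrArg (b S · x) (act_add_right M _ m m')).trans (hadd _ _ _ _)
        rw [← AddMonoidHom.add_comp, ← map_add]
        exact congrArg (fun z => (Finsupp.liftAddHom z).comp _) (funext hc)
  have hβ S m x (r : R.obj.obj S) : β S m (MonoidAlgebra.single x r) =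
      b S (act M (MonoidAlgebra.single 1 r) m) x :=
    Finsupp.liftAddHom_apply_single (c S m) x r
  have hβnat {S T : Stonean.{u}ᵒᵖ} (f : S ⟶ T) (m : M.val.obj S)
      (a : MonoidAlgebra (R.obj.obj S) (G.obj.obj S)) :
      β T (restr M f m) (grRestr R G f a) = restr Q f (β S m a) := by
    induction a using MonoidAlgebra.induction_linear with
    | zero => rw [map_zero, map_zero, map_zero, map_zero]
    | add a b ha hb => rw [map_add, map_add, map_add, map_add, ha, hb]
    | single x r =>
      rw [grRestr_single, hβ, hβ, ← hnat, restr_act, grRestr_single, map_one]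
  have hβbal S (h : Γ.obj.obj S) (r : R.obj.obj S) (m : M.val.obj S)
      (a : MonoidAlgebra (R.obj.obj S) (G.obj.obj S)) :
      β S (act M (MonoidAlgebra.single h r) m) a =
        β S m (grMap R i S (MonoidAlgebra.single h r) * a) := by
    induction a using MonoidAlgebra.induction_linear with
    | zero => rw [mul_zero, map_zero, map_zero]
    | add a b ha hb => rw [mul_add, map_add, map_add, ha, hb]
    | single x r' =>
      rw [grMap_single, MonoidAlgebra.single_mul_single, hβ, hβ, ← hbal, ← act_mul, ← act_mul,
        MonoidAlgebra.single_mul_single, MonoidAlgebra.single_mul_single, one_mul, mul_one,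
        mul_one]
  obtain ⟨β', hnat', hβ'⟩ := exists_extension (toRegular R G) β fun f m n => hβnat f m n
  obtain ⟨F, hF⟩ := exists_natAddHom_tensor (N := Bimod.ofHom (groupRingMap R i)) β' hnat'
    (balanced_of_single (N := Bimod.ofHom (groupRingMap R i)) β' hnat' fun S x r m n => by
      obtain ⟨C, hC, hc⟩ := exists_cover_regular (S := S.unop) n
      refine RightMod.ext_of_cover Q (S := S.unop) hC fun T f hf => ?_
      obtain ⟨n₀, hn₀⟩ := hc f hf
      refine (hnat' f.op _ _).symm.trans (Eq.trans ?_ (hnat' f.op _ _))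
      have h₁ := (Bimod.ofHom (groupRingMap R i)).restr_smul f.op
        (toGR R Γ S (MonoidAlgebra.single x r)) n
      rw [← toGR_grRestr] at h₁
      refine Eq.trans ?_ (congrArg (β' (op T) _) h₁).symm
      rw [restr_act, grRestr_single]
      refine (congrArg (β' (op T) _) hn₀).symm.trans ?_
      refine (hβ' _ _ _).trans ((hβbal _ _ _ _ _).trans ((hβ' _ _ _).symm.trans ?_))
      refine congrArg (β' (op T) _) ?_
      refine (map_mul (toGR R G (op T)) _ _).trans ?_
      rw [← groupRingMap_toGR]
      exact congrArg (fun z => ((groupRingMap R i).hom.app (op T)).hom (toGR R Γ (op T)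
        (MonoidAlgebra.single _ _)) * z) hn₀)
  exact ⟨F, fun S m x r => (hF S m _).trans ((hβ' S m _).trans (hβ S m x r))⟩

end Ind

/-! ### Mackey's formula -/

variable {G : CondGrp.{u}} {H K : CondSubgroup G} {rep : H.DoubleCosets K → CondGrp.underlying G}
  {M : RightMod (groupRing R H.toCondGrp)} {P : RightMod (groupRing R K.toCondGrp)}

lemma act_res_indMk {S : Stonean.{u}ᵒᵖ} (m : M.val.obj S) (x : G.obj.obj S) (r r' : R.obj.obj S)
    (k : K.toCondGrp.obj.obj S) :
    act ((res (groupRingMap R K.incl)).obj (ind R H.incl M)) (MonoidAlgebra.single k r')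
        (indMk H.incl M m (toGR R G S (MonoidAlgebra.single x r))) =
      indMk H.incl M m (toGR R G S (MonoidAlgebra.single (x * K.coe S k) (r * r'))) := by
  refine (act_res K.incl (ind R H.incl M) _ _).trans ?_
  rw [act_indMk, grMap_single, ← map_mul, MonoidAlgebra.single_mul_single]
  rfl

/-- The canonical map from a Mackey term to the restriction of the induced module. -/
def mackeyHom (H K : CondSubgroup G) (M : RightMod (groupRing R H.toCondGrp))
    (g : CondGrp.underlying G) :
    mackeyTerm R H K M g ⟶ (res (groupRingMap R K.incl)).obj (ind R H.incl M) :=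
  (exists_mackeyTerm_hom R H g M K).choose

lemma mackeyHom_mackeyMk {g : CondGrp.underlying G} {S : Stonean.{u}ᵒᵖ} (m : M.val.obj S) :
    (mackeyHom H K M g).val.app S (mackeyMk H K g M m (cosetGen R H g S)) =
      indMk H.incl M m (toGR R G S (MonoidAlgebra.single (CondGrp.const G g S) 1)) :=
  (exists_mackeyTerm_hom R H g M K).choose_spec S m (cosetGen R H g S)

variable (hHK : H.IsOpen ∨ K.IsOpen)
  (hrep : ∀ d, DoubleCoset.mk (H.obj (op pt)) (K.obj (op pt)) (rep d) = d)

include hHK hrep in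
-- Existence in the universal property. The `γ d` restrict to twisted maps, which glue to a balanced
-- map on `M × G` and hence to a map on the induced module; it agrees with `γ d` on the generating
-- sections `(m ⊗ g) ⊗ 1` by `glued_rep`.
lemma exists_mackey_desc (γ : ∀ d, mackeyTerm R H K M (rep d) ⟶ P) :
    ∃ E : (res (groupRingMap R K.incl)).obj (ind R H.incl M) ⟶ P,
      ∀ d, mackeyHom H K M (rep d) ≫ E = γ d := by
  let δ (d : H.DoubleCosets K) : TwistedHom M P (rep d) := TwistedHom.ofHom (γ d)
  obtain ⟨F, hF⟩ := exists_natAddHom_ind (i := H.incl) (M := M) (Q := P)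
    (fun S m x => glued hHK hrep δ (S := S.unop) m x)
    (fun S m m' x => glued_add hHK hrep δ m m' x)
    (fun f m x => restr_glued hHK hrep δ f.unop m x)
    (fun S h m x => glued_act_left hHK hrep δ h m x)
  let F' : NatAddHom ((res (groupRingMap R K.incl)).obj (ind R H.incl M)) P :=
    ⟨F.app, F.naturality⟩
  have hlin : ∀ S (k : K.toCondGrp.obj.obj S) (r : R.obj.obj S)
      (t : (ind R H.incl M).val.obj S),
      F.app S (act (ind R H.incl M) (MonoidAlgebra.single (K.coe S k) r) t) =
        act P (MonoidAlgebra.single k r) (F.app S t) := by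
    intro S k r t
    -- On `m ⊗ r₀ x` the element `r k` acts by `m ⊗ r₀ r (x k)`: the factor `k` is handled by
    -- `glued_act_right`, and `r` by `glued_act_scalar` after `r₀` has been moved to `m`.
    refine F.map_act_of_indMk _ _ (fun T f m x r₀ => ?_) t
    rw [grRestr_single, grRestr_single, MonoidAlgebra.single_mul_single, hF, hF,
      CondSubgroup.map_coe]
    generalize (K.toCondGrp.obj.map f).hom k = k', (R.obj.map f).hom r = r'
    refine (glued_act_right hHK hrep δ (S := T.unop) k' _ x).trans ?_
    have e₁ : act M (MonoidAlgebra.single 1 (r₀ * r')) m =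
        act M (MonoidAlgebra.single 1 r') (act M (MonoidAlgebra.single 1 r₀) m) := by
      rw [← act_mul, MonoidAlgebra.single_mul_single, one_mul]
    refine (congrArg (act P (MonoidAlgebra.single k' 1))
      ((congrArg (fun z => glued hHK hrep δ (S := T.unop) z x) e₁).trans
        (glued_act_scalar hHK hrep δ (S := T.unop) r' _ x))).trans ?_
    rw [← act_mul, MonoidAlgebra.single_mul_single, one_mul, mul_one]
  refine ⟨F'.toHom (F'.linear_of_single fun S k r t => ?_), fun d => ?_⟩
  · refine (congrArg (F.app S) ((act_res K.incl (ind R H.incl M) _ _).trans ?_)).trans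
      (hlin S k r t)
    rw [grMap_single]
    rfl
  · refine mackeyTerm_hom_ext fun S m => ?_
    refine (congrArg (F.app S) (mackeyHom_mackeyMk m)).trans ((hF S m _ 1).trans ?_)
    refine (glued_rep hHK hrep δ (S := S.unop) _ d).trans ?_
    rw [← MonoidAlgebra.one_def, act_one]
    rfl

include hHK hrep in
-- Uniqueness in the universal property. The hypothesis gives agreement on `m ⊗ g` for the
-- representatives `g`; since `m ⊗ h g k = (m h ⊗ g) k`, `K`-linearity extends it to all `m ⊗ h g
-- k`, and every `m ⊗ x` is locally of this form.
lemma mackey_hom_ext {E E' : (res (groupRingMap R K.incl)).obj (ind R H.incl M) ⟶ P}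
    (h : ∀ d, mackeyHom H K M (rep d) ≫ E = mackeyHom H K M (rep d) ≫ E') : E = E' := by
  have h₁ (d : H.DoubleCosets K) (S : Stonean.{u}ᵒᵖ) (m : M.val.obj S) :
      E.val.app S (indMk H.incl M m (toGR R G S
        (MonoidAlgebra.single (CondGrp.const G (rep d) S) 1))) =
      E'.val.app S (indMk H.incl M m (toGR R G S
        (MonoidAlgebra.single (CondGrp.const G (rep d) S) 1))) := by
    rw [← mackeyHom_mackeyMk (K := K)]
    exact ConcreteCategory.congr_hom (congrArg (fun z => z.val.app S) (h d)) _
  have h₂ (d : H.DoubleCosets K) (S : Stonean.{u}ᵒᵖ) (h : H.toCondGrp.obj.obj S)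
      (k : K.toCondGrp.obj.obj S) (m : M.val.obj S) :
      E.val.app S (indMk H.incl M m (toGR R G S
        (MonoidAlgebra.single (H.coe S h * CondGrp.const G (rep d) S * K.coe S k) 1))) =
      E'.val.app S (indMk H.incl M m (toGR R G S
        (MonoidAlgebra.single (H.coe S h * CondGrp.const G (rep d) S * K.coe S k) 1))) := by
    have e₁ : indMk H.incl M m (toGR R G S
        (MonoidAlgebra.single (H.coe S h * CondGrp.const G (rep d) S * K.coe S k) 1)) =
        act ((res (groupRingMap R K.incl)).obj (ind R H.incl M)) (MonoidAlgebra.single k 1)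
          (indMk H.incl M (act M (MonoidAlgebra.single h 1) m) (toGR R G S
            (MonoidAlgebra.single (CondGrp.const G (rep d) S) 1))) := by
      rw [act_res_indMk, indMk_act, grMap_single, ← map_mul, MonoidAlgebra.single_mul_single,
        mul_one, mul_one, mul_assoc]
      rfl
    rw [e₁]
    refine (RightMod.hom_map_smul E _ _).trans (Eq.trans ?_ (RightMod.hom_map_smul E' _ _).symm)
    rw [h₁]
  have key (S : Stonean.{u}ᵒᵖ) (t : (ind R H.incl M).val.obj S) :
      E.val.app S t = E'.val.app S t := by
    let F (E : (res (groupRingMap R K.incl)).obj (ind R H.incl M) ⟶ P) :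
        NatAddHom (ind R H.incl M) P :=
      ⟨(NatAddHom.ofHom E).app, (NatAddHom.ofHom E).naturality⟩
    refine natAddHom_ext_indMk (F := F E) (F' := F E') (fun S m x => ?_)
      (S := S) (t := t)
    refine P.ext_of_cover (S := S.unop) (decompSieve_mem hHK hrep x) fun T f ⟨d, h, k, e⟩ => ?_
    refine ((F E).naturality f.op _).symm.trans (Eq.trans ?_ ((F E').naturality f.op _))
    rw [restr_indMk, ← toGR_grRestr, grRestr_single, map_one]
    have e' : (G.obj.map f.op).hom x = _ := e
    rw [e']
    exact h₂ d _ h k _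
  refine SheafOfModules.hom_ext (PresheafOfModules.hom_ext fun S => ?_)
  exact ModuleCat.hom_ext (LinearMap.ext fun x => key S x)

end

end

end CondMackey

/-- The maps `mackeyHom` form a colimit cofan by `exists_mackey_desc` and `mackey_hom_ext`, and two
coproducts of the same family are isomorphic. -/
theorem theorem5 (R : CondRing.{u}) (G : CondGrp.{u}) (H K : CondSubgroup G)
    (hHK : H.IsOpen ∨ K.IsOpen) (M : RightMod (groupRing R H.toCondGrp))
    (rep : H.DoubleCosets K → CondGrp.underlying G)
    (hrep : ∀ d, DoubleCoset.mk (H.obj (op pt)) (K.obj (op pt)) (rep d) = d) :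
    Nonempty ((res (groupRingMap R K.incl)).obj (ind R H.incl M) ≅
      ∐ fun d : H.DoubleCosets K => mackeyTerm R H K M (rep d)) := by
  choose desc hdesc using fun P (γ : ∀ d, mackeyTerm R H K M (rep d) ⟶ P) =>
    exists_mackey_desc hHK hrep γ
  have hc : IsColimit (Cofan.mk _ fun d => mackeyHom H K M (rep d)) :=
    Cofan.IsColimit.mk _ (fun s => desc s.pt s.inj) (fun s d => hdesc s.pt s.inj d)
      fun s E hE => mackey_hom_ext hHK hrep fun d => (hE d).trans (hdesc s.pt s.inj d).symm
  exact ⟨hc.coconePointUniqueUpToIso (coproductIsCoproduct _)⟩
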